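/- Let $F:\mathbb{S}^n\to\mathbb{R}$ be a smooth positive function such that $A_F:=D^2F+F\,I$ is positive definite on $T_u\mathbb{S}^n$ for every $u\in\mathbb{S}^n$, where $D^2F$ is the Hessian of $F$ on the round unit sphere $\mathbb{S}^n\subset\mathbb{R}^{n+1}$, and let $\phi:\mathbb{S}^n\to\mathbb{R}^{n+1}$, $\phi(u)=DF_u+F(u)u$, where $DF$ is the gradient of $F$ on $\mathbb{S}^n$. Let $x:M\to\mathbb{R}^{n+1}$ be a smooth immersed oriented hypersurface without boundary, with Gauss map $\nu:M\to\mathbb{S}^n$, which is complete in the induced Riemannian metric. The anisotropic principal curvatures of $x$ at $p\in M$ are the eigenvalues of the $F$-Weingarten operator $S_F=-d(\phi\circ\nu):T_pM\to T_{\nu(p)}\mathbb{S}^n=dx(T_pM)\cong T_pM$, that is, the real numbers $\lambda$ for which $-d(\phi\circ\nu)(X)=\lambda\,dx(X)$ for some $0\neq X\in T_pM$. Suppose that $M$ is anisotropic isoparametric, i.e. that its anisotropic principal curvatures, counted with multiplicity, are constant on $M$. Then the number $g$ of distinct anisotropic principal curvatures satisfies $g\le 2$, and if $g=2$ then one of the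 two anisotropic principal curvatures is $0$. -/

import Mathlib

open Bundle
open scoped Manifold ContDiff InnerProductSpace

noncomputable section

namespace AnisotropicHypersurface

/-- The Euclidean space `ℝ^{n+1}`. -/
abbrev Ambient (n : ℕ) : Type := EuclideanSpace ℝ (Fin (n + 1))

/-- The unit sphere `S^n ⊂ ℝ^{n+1}`. -/
abbrev UnitSphere (n : ℕ) : Type := Metric.sphere (0 : Ambient n) 1

variable {n : ℕ}

/-- The radially constant extension `y ↦ F (y / |y|)` of a function `F` on the sphere. The value at
the origin is irrelevant: the extension is only ever differentiated at unit vectors. -/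
def radialExtension (F : UnitSphere n → ℝ) (y : Ambient n) : ℝ :=
  open Classical in
  if hy : y ≠ 0 then
    F ⟨‖y‖⁻¹ • y, by
      rw [mem_sphere_zero_iff_norm, norm_smul, norm_inv, norm_norm,
        inv_mul_cancel₀ (norm_ne_zero_iff.mpr hy)]⟩
  else 0

/-- The gradient `DF_u` of `F` on the sphere. As the extension is constant along rays, its Euclidean
gradient at `u` is tangent to the sphere and represents the differential of `F` at `u`. -/
def sphereGradient (F : UnitSphere n → ℝ) (u : UnitSphere n) : Ambient n :=
  gradient (radialExtension F) (u : Ambient n)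

/-- The Hessian `D²F_u(X, Y)` of `F` on the round sphere, for `X, Y` tangent to the sphere at `u`,
that is, orthogonal to `u`. The Euclidean Hessian of the radially constant extension has no normal
correction term, because the radial derivative of the extension vanishes. -/
def sphereHessian (F : UnitSphere n → ℝ) (u : UnitSphere n) (X Y : Ambient n) : ℝ :=
  fderiv ℝ (fderiv ℝ (radialExtension F)) (u : Ambient n) X Y

/-- A smooth positive function `F` on `S^n` such that `A_F = D²F + F I` is positive definite on
every tangent space `T_u S^n = u^⊥`. -/
structure IsAnisotropicDensity (F : UnitSphere n → ℝ) : Prop where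
  smooth : ContMDiff (𝓡 n) 𝓘(ℝ, ℝ) ∞ F
  pos : ∀ u, 0 < F u
  convex : ∀ (u : UnitSphere n) (X : Ambient n), ⟪(u : Ambient n), X⟫_ℝ = 0 → X ≠ 0 →
    0 < sphereHessian F u X X + F u * ⟪X, X⟫_ℝ

/-- The map `φ(u) = DF_u + F(u) u`, whose image is the Wulff shape. -/
def wulffMap (F : UnitSphere n → ℝ) (u : UnitSphere n) : Ambient n :=
  sphereGradient F u + F u • (u : Ambient n)

variable {M : Type*} [TopologicalSpace M] [ChartedSpace (EuclideanSpace ℝ (Fin n)) M]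

/-- The differential at `p` of a map from an `n`-manifold to `ℝ^{n+1}`. -/
def differential (f : M → Ambient n) (p : M) : TangentSpace (𝓡 n) p →ₗ[ℝ] Ambient n :=
  (mfderiv (𝓡 n) 𝓘(ℝ, Ambient n) f p).toLinearMap

/-- `x : M → ℝ^{n+1}` is a smooth immersed oriented hypersurface with Gauss map `ν`, and the
Riemannian metric of `M` is the one induced by `x`. -/
structure IsOrientedHypersurface [RiemannianBundle (fun p : M ↦ TangentSpace (𝓡 n) p)]
    (x : M → Ambient n) (ν : M → UnitSphere n) : Prop where
  smooth : ContMDiff (𝓡 n) 𝓘(ℝ, Ambient n) ∞ x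
  isometric : ∀ (p : M) (X : TangentSpace (𝓡 n) p), ‖differential x p X‖ = ‖X‖
  smooth_gauss : ContMDiff (𝓡 n) (𝓡 n) ∞ ν
  normal : ∀ (p : M) (X : TangentSpace (𝓡 n) p),
    ⟪(ν p : Ambient n), differential x p X⟫_ℝ = 0

/-- The `F`-Weingarten operator `S_F = -d(φ ∘ ν)`. It takes values in
`T_{ν(p)} S^n = dx (T_p M)`, which is identified with `T_p M` through `dx`. -/
def weingarten (F : UnitSphere n → ℝ) (ν : M → UnitSphere n) (p : M) :
    TangentSpace (𝓡 n) p →ₗ[ℝ] Ambient n :=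
  -differential (fun q ↦ wulffMap F (ν q)) p

/-- The eigenspace `{X ∈ T_p M | S_F X = μ X}`, where `T_p M` is identified with its image under
`dx`. -/
def eigenspace (F : UnitSphere n → ℝ) (x : M → Ambient n) (ν : M → UnitSphere n) (p : M) (μ : ℝ) :
    Submodule ℝ (TangentSpace (𝓡 n) p) :=
  LinearMap.ker (weingarten F ν p - μ • differential x p)

/-- The set of anisotropic principal curvatures at `p`: the eigenvalues of `S_F`. -/
def principalCurvatures (F : UnitSphere n → ℝ) (x : M → Ambient n) (ν : M → UnitSphere n) (p : M) :
    Set ℝ :=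
  {μ | eigenspace F x ν p μ ≠ ⊥}

/-- The anisotropic principal curvatures, counted with multiplicity, are constant on `M`. (The
operator `S_F` is diagonalizable, so multiplicities are dimensions of eigenspaces.) -/
def IsAnisotropicIsoparametric (F : UnitSphere n → ℝ) (x : M → Ambient n)
    (ν : M → UnitSphere n) : Prop :=
  ∀ (p q : M) (μ : ℝ),
    Module.finrank ℝ (eigenspace F x ν p μ) = Module.finrank ℝ (eigenspace F x ν q μ)

end AnisotropicHypersurface

end

/-! Let `l` be a nonzero anisotropic principal curvature and f = x + l⁻¹ φ∘ν the focal map. On u^⊥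
the differential of φ is A_F, so df = dx + l⁻¹ A_F dν is orthogonal to ν and its kernel is the
`l`-eigenspace. Constant multiplicities give f constant rank: its image is locally a submanifold
with tangent space T = range df, and ν maps the fibre of f locally onto an open piece of the unit
sphere of T^⊥ (`IsTubular.exists_section`).

On a fibre x = f(p) - l⁻¹ φ(ν), so x moves with bounded speed when ν runs along a great circle of
T^⊥. Completeness of M then allows continuation up to a point q of the fibre with normal -ν(p)
(`IsOrientedHypersurface.exists_opposite`). Different sheets of the focal image may pass through the
same focal point; a fixed local retraction H onto one sheet (`IsFocalRetraction`) is carried along,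
so that p and q lie over the same sheet.

The form ⟨dν v, df w⟩ is, up to sign, the second fundamental form of that sheet in the direction ν
(`IsFocalRetraction.inner_eq`), so it takes opposite values at p and q on the same tangent vectors.
Diagonalization relative to A_F shows that on the eigenspace of μ it has the sign of -μ(1 - μ/l)
(`IsOrientedHypersurface.focalForm_nonneg`). If `l` is the smallest positive curvature or, when none
is positive, the negative one nearest to 0, this sign is weakly the same for all μ, both at p and at
q because the curvatures are constant. Hence the form has vanishing diagonal values at p, and μ is 0
or `l`. -/

namespace AnisotropicHypersurface

open Filter Topology

/-! ### The Wulff map and its differential A_F -/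

section WulffExtension

variable {n : ℕ} {F : UnitSphere n → ℝ}

theorem radialExtension_coe (F : UnitSphere n → ℝ) (u : UnitSphere n) :
    radialExtension F (u : Ambient n) = F u := by
  have hu : ‖(u : Ambient n)‖ = 1 := by simp
  have h0 : (u : Ambient n) ≠ 0 := norm_ne_zero_iff.mp (by rw [hu]; exact one_ne_zero)
  rw [radialExtension, dif_pos h0]
  congr 1
  ext1
  simp [hu]

theorem radialExtension_smul (F : UnitSphere n → ℝ) {t : ℝ} (ht : 0 < t) (y : Ambient n) :
    radialExtension F (t • y) = radialExtension F y := by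
  by_cases hy : y = 0
  · simp [hy]
  · have hty : t • y ≠ 0 := smul_ne_zero ht.ne' hy
    rw [radialExtension, radialExtension, dif_pos hy, dif_pos hty]
    congr 1
    ext1
    simp only [norm_smul, Real.norm_eq_abs, abs_of_pos ht, smul_smul]
    congr 1
    field_simp

theorem contDiffAt_radialExtension (hF : ContMDiff (𝓡 n) 𝓘(ℝ, ℝ) ∞ F) {y : Ambient n}
    (hy : y ≠ 0) : ContDiffAt ℝ ∞ (radialExtension F) y := by
  let U : TopologicalSpace.Opens (Ambient n) := ⟨{0}ᶜ, isOpen_compl_singleton⟩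
  have hunit : ∀ z : U, ‖(z : Ambient n)‖⁻¹ • (z : Ambient n) ∈ Metric.sphere (0 : Ambient n) 1 := by
    intro z
    have hz : (z : Ambient n) ≠ 0 := z.2
    rw [mem_sphere_zero_iff_norm, norm_smul, norm_inv, norm_norm,
      inv_mul_cancel₀ (norm_ne_zero_iff.mpr hz)]
  have hnorm : ContMDiff 𝓘(ℝ, Ambient n) 𝓘(ℝ, Ambient n) ∞
      (fun z : U ↦ ‖(z : Ambient n)‖⁻¹ • (z : Ambient n)) := by
    intro z
    have hz : (z : Ambient n) ≠ 0 := z.2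
    refine (contMDiffAt_subtype_iff (f := fun y : Ambient n ↦ ‖y‖⁻¹ • y) (x := z)).mpr ?_
    exact (((contDiffAt_norm ℝ hz).inv (norm_ne_zero_iff.mpr hz)).smul contDiffAt_id).contMDiffAt
  have : Fact (Module.finrank ℝ (Ambient n) = n + 1) := ⟨by simp⟩
  have h := hF.comp (hnorm.codRestrict_sphere (n := n) hunit)
  have key : ContMDiffAt 𝓘(ℝ, Ambient n) 𝓘(ℝ, ℝ) ∞
      (fun z : U ↦ radialExtension F z) (⟨y, hy⟩ : U) := by
    refine (h ⟨y, hy⟩).congr_of_eventuallyEq (Eventually.of_forall fun z ↦ ?_)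
    have hz : (z : Ambient n) ≠ 0 := z.2
    simp only [radialExtension, dif_pos hz]
    rfl
  exact (contMDiffAt_subtype_iff.mp key).contDiffAt

/-- The extension `y ↦ ∇F₀(y) + F₀(y) y` of the Wulff map, where `F₀` is the radially constant
extension of `F`. -/
noncomputable def wulffExtension (F : UnitSphere n → ℝ) (y : Ambient n) : Ambient n :=
  gradient (radialExtension F) y + radialExtension F y • y

theorem wulffMap_eq (F : UnitSphere n → ℝ) (u : UnitSphere n) :
    wulffMap F u = wulffExtension F u := by
  rw [wulffMap, wulffExtension, radialExtension_coe, sphereGradient]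

theorem contDiffAt_wulffExtension (hF : ContMDiff (𝓡 n) 𝓘(ℝ, ℝ) ∞ F) {y : Ambient n}
    (hy : y ≠ 0) : ContDiffAt ℝ ∞ (wulffExtension F) y := by
  have h := contDiffAt_radialExtension hF hy
  refine ContDiffAt.add ?_ (h.smul contDiffAt_id)
  exact (InnerProductSpace.toDual ℝ (Ambient n)).symm.contDiff.contDiffAt.comp y
    (h.fderiv_right (m := ∞) (by simp))

theorem inner_fderiv_wulffExtension (hF : ContMDiff (𝓡 n) 𝓘(ℝ, ℝ) ∞ F) (u : UnitSphere n)
    (v w : Ambient n) :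
    ⟪fderiv ℝ (wulffExtension F) u v, w⟫_ℝ =
      sphereHessian F u v w + F u * ⟪v, w⟫_ℝ +
        fderiv ℝ (radialExtension F) u v * ⟪(u : Ambient n), w⟫_ℝ := by
  have h0 : (u : Ambient n) ≠ 0 := norm_ne_zero_iff.mp (by simp)
  have h := contDiffAt_radialExtension hF h0
  have h1 : HasFDerivAt (radialExtension F) (fderiv ℝ (radialExtension F) u) (u : Ambient n) :=
    (h.differentiableAt (by simp)).hasFDerivAt
  have h2 : HasFDerivAt (fderiv ℝ (radialExtension F))
      (fderiv ℝ (fderiv ℝ (radialExtension F)) u) (u : Ambient n) :=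
    ((h.fderiv_right (m := ∞) (by simp)).differentiableAt (by simp)).hasFDerivAt
  let D : (Ambient n →L[ℝ] ℝ) →L[ℝ] Ambient n :=
    { toFun := (InnerProductSpace.toDual ℝ (Ambient n)).symm
      map_add' := map_add _
      map_smul' := fun c l ↦ by simp
      cont := (InnerProductSpace.toDual ℝ (Ambient n)).symm.continuous }
  have h3 : HasFDerivAt (wulffExtension F) (D ∘L fderiv ℝ (fderiv ℝ (radialExtension F)) u +
      (radialExtension F u • ContinuousLinearMap.id ℝ (Ambient n) +
        (fderiv ℝ (radialExtension F) u).smulRight (id (u : Ambient n)))) (u : Ambient n) :=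
    (D.hasFDerivAt.comp _ h2).add (h1.smul (hasFDerivAt_id _))
  rw [h3.fderiv, sphereHessian]
  have hD : ∀ l : Ambient n →L[ℝ] ℝ, ⟪D l, w⟫_ℝ = l w := fun l ↦
    InnerProductSpace.toDual_symm_apply (𝕜 := ℝ)
  simp only [add_apply, inner_add_left, ContinuousLinearMap.comp_apply, hD,
    smul_apply, inner_smul_left, ContinuousLinearMap.smulRight_apply,
    radialExtension_coe, ContinuousLinearMap.id_apply]
  simp
  ring

theorem fderiv_radialExtension_self (hF : ContMDiff (𝓡 n) 𝓘(ℝ, ℝ) ∞ F) {y : Ambient n}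
    (hy : y ≠ 0) : fderiv ℝ (radialExtension F) y y = 0 := by
  have h1 : HasFDerivAt (radialExtension F) (fderiv ℝ (radialExtension F) y) ((1 : ℝ) • y) := by
    rw [one_smul]
    exact ((contDiffAt_radialExtension hF hy).differentiableAt (by simp)).hasFDerivAt
  have h2 : HasDerivAt (fun t : ℝ ↦ t • y) y 1 := by
    simpa using (hasDerivAt_id (1 : ℝ)).smul_const y
  have h3 := h1.comp_hasDerivAt (1 : ℝ) h2
  refine h3.unique ((hasDerivAt_const (1 : ℝ) (radialExtension F y)).congr_of_eventuallyEq ?_)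
  filter_upwards [lt_mem_nhds (zero_lt_one (α := ℝ))] with t ht
  exact radialExtension_smul F ht y

theorem sphereHessian_comm (hF : ContMDiff (𝓡 n) 𝓘(ℝ, ℝ) ∞ F) (u : UnitSphere n)
    (v w : Ambient n) : sphereHessian F u v w = sphereHessian F u w v := by
  have h0 : (u : Ambient n) ≠ 0 := norm_ne_zero_iff.mp (by simp)
  exact (contDiffAt_radialExtension hF h0).isSymmSndFDerivAt
    (by simp only [minSmoothness_of_isRCLikeNormedField]; exact WithTop.coe_le_coe.mpr le_top) v w

/-- Comes from differentiating the Euler relation `fderiv_radialExtension_self` in the direction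
`v`. -/
theorem sphereHessian_self_right (hF : ContMDiff (𝓡 n) 𝓘(ℝ, ℝ) ∞ F) (u : UnitSphere n)
    (v : Ambient n) : sphereHessian F u v u = -fderiv ℝ (radialExtension F) u v := by
  have h0 : (u : Ambient n) ≠ 0 := norm_ne_zero_iff.mp (by simp)
  have h := contDiffAt_radialExtension hF h0
  have h2 : HasFDerivAt (fderiv ℝ (radialExtension F))
      (fderiv ℝ (fderiv ℝ (radialExtension F)) u) (u : Ambient n) :=
    ((h.fderiv_right (m := ∞) (by simp)).differentiableAt (by simp)).hasFDerivAt
  have h3 := HasFDerivAt.clm_apply (𝕜 := ℝ) (E := Ambient n) (G := Ambient n) (H := ℝ) (u := id)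
    h2 (hasFDerivAt_id (u : Ambient n))
  have h4 : HasFDerivAt (fun y : Ambient n ↦ fderiv ℝ (radialExtension F) y (id y))
      (0 : Ambient n →L[ℝ] ℝ) (u : Ambient n) := by
    refine (hasFDerivAt_const (0 : ℝ) (u : Ambient n)).congr_of_eventuallyEq ?_
    filter_upwards [isOpen_ne.mem_nhds h0] with y hy
    exact fderiv_radialExtension_self hF hy
  have h5 := congrArg (fun l : Ambient n →L[ℝ] ℝ ↦ l v) (h3.unique h4)
  simp at h5
  rw [sphereHessian]
  linarith

theorem fderiv_wulffExtension_symm (hF : ContMDiff (𝓡 n) 𝓘(ℝ, ℝ) ∞ F) (u : UnitSphere n)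
    {v w : Ambient n} (hv : ⟪(u : Ambient n), v⟫_ℝ = 0) (hw : ⟪(u : Ambient n), w⟫_ℝ = 0) :
    ⟪fderiv ℝ (wulffExtension F) u v, w⟫_ℝ = ⟪v, fderiv ℝ (wulffExtension F) u w⟫_ℝ := by
  rw [real_inner_comm _ v, inner_fderiv_wulffExtension hF, inner_fderiv_wulffExtension hF, hv, hw,
    sphereHessian_comm hF, real_inner_comm v w, mul_zero, mul_zero]

/-- The Hessian term in the direction `u` cancels the derivative of the coefficient of u in F(u)u.
Thus dφ preserves u^⊥, which makes ν normal to the focal map as well. -/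
theorem inner_fderiv_wulffExtension_self (hF : ContMDiff (𝓡 n) 𝓘(ℝ, ℝ) ∞ F) (u : UnitSphere n)
    {v : Ambient n} (hv : ⟪(u : Ambient n), v⟫_ℝ = 0) :
    ⟪(u : Ambient n), fderiv ℝ (wulffExtension F) u v⟫_ℝ = 0 := by
  have hu : ⟪(u : Ambient n), (u : Ambient n)⟫_ℝ = 1 := by simp
  rw [real_inner_comm, inner_fderiv_wulffExtension hF, sphereHessian_self_right hF,
    real_inner_comm, hv, hu]
  ring

theorem fderiv_wulffExtension_pos (hF : IsAnisotropicDensity F) (u : UnitSphere n)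
    {v : Ambient n} (hv : ⟪(u : Ambient n), v⟫_ℝ = 0) (h0 : v ≠ 0) :
    0 < ⟪fderiv ℝ (wulffExtension F) u v, v⟫_ℝ := by
  rw [inner_fderiv_wulffExtension hF.smooth, hv, mul_zero, add_zero]
  exact hF.convex u v hv h0

end WulffExtension

/-! ### Sign of a quadratic form from the eigenvalues of a product of symmetric operators -/

section Pencil

open Module

theorem LinearMap.IsSymmetric.quadratic_nonneg {V : Type*} [NormedAddCommGroup V]
    [InnerProductSpace ℝ V] [FiniteDimensional ℝ V] {T : V →ₗ[ℝ] V} (hT : T.IsSymmetric)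
    {ε l : ℝ} (h : ∀ (μ : ℝ) (a : V), a ≠ 0 → T a = μ • a → 0 ≤ ε * (μ * (1 + l * μ))) (a : V) :
    0 ≤ ε * ⟪T a, a + l • T a⟫_ℝ := by
  let b := hT.eigenvectorBasis rfl
  have hb : ∀ i, ⟪b i, T a⟫_ℝ = hT.eigenvalues rfl i * ⟪b i, a⟫_ℝ := by
    intro i
    have := hT.eigenvectorBasis_apply_self_apply rfl a i
    simpa [OrthonormalBasis.repr_apply_apply] using this
  rw [← b.sum_inner_mul_inner, Finset.mul_sum]
  refine Finset.sum_nonneg fun i _ ↦ ?_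
  have hi := h (hT.eigenvalues rfl i) (b i) (b.orthonormal.ne_zero i)
    (hT.apply_eigenvectorBasis rfl i)
  rw [real_inner_comm, inner_add_right, inner_smul_right, hb]
  have : ε * (hT.eigenvalues rfl i * ⟪b i, a⟫_ℝ *
      (⟪b i, a⟫_ℝ + l * (hT.eigenvalues rfl i * ⟪b i, a⟫_ℝ))) =
      ε * (hT.eigenvalues rfl i * (1 + l * hT.eigenvalues rfl i)) * ⟪b i, a⟫_ℝ ^ 2 := by ring
  rw [this]
  positivity

theorem quadratic_nonneg_of_bilin {V : Type*} [AddCommGroup V] [Module ℝ V]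
    [FiniteDimensional ℝ V] (B : V →ₗ[ℝ] V →ₗ[ℝ] ℝ) (hsymm : ∀ x y, B x y = B y x)
    (hpos : ∀ x, x ≠ 0 → 0 < B x x) {T : V →ₗ[ℝ] V} (hT : ∀ x y, B (T x) y = B x (T y))
    {ε l : ℝ} (h : ∀ (μ : ℝ) (a : V), a ≠ 0 → T a = μ • a → 0 ≤ ε * (μ * (1 + l * μ))) (a : V) :
    0 ≤ ε * B (T a) (a + l • T a) := by
  let c : InnerProductSpace.Core ℝ V :=
    { inner := fun x y ↦ B x y
      conj_inner_symm := fun x y ↦ hsymm y x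
      re_inner_nonneg := fun x ↦ by
        by_cases hx : x = 0
        · simp [hx]
        · exact (hpos x hx).le
      add_left := fun x y z ↦ by simp
      smul_left := fun x y r ↦ by simp
      definite := fun x hx ↦ by
        by_contra h0
        exact (hpos x h0).ne' hx }
  let _ : NormedAddCommGroup V := c.toNormedAddCommGroup
  let _ : InnerProductSpace ℝ V := InnerProductSpace.ofCore c.toCore
  exact LinearMap.IsSymmetric.quadratic_nonneg (T := T) (fun x y ↦ hT x y) h a

/-- The product `A L` is not symmetric, but with v = A a the form becomes B(T a, a + l T a), where T
= L A is symmetric for the inner product B(x, y) = ⟨A x, y⟩. Eigenvectors x of T correspond to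
eigenvectors A x of `A L` with the same eigenvalue. -/
theorem pencil_nonneg {V : Type*} [NormedAddCommGroup V] [InnerProductSpace ℝ V]
    [FiniteDimensional ℝ V] {A L : V →ₗ[ℝ] V} (hA : A.IsSymmetric)
    (hpos : ∀ x, x ≠ 0 → 0 < ⟪A x, x⟫_ℝ) (hL : L.IsSymmetric) {ε l : ℝ}
    (h : ∀ (μ : ℝ) (v : V), v ≠ 0 → A (L v) = μ • v → 0 ≤ ε * (μ * (1 + l * μ))) (v : V) :
    0 ≤ ε * ⟪L v, v + l • A (L v)⟫_ℝ := by
  have hinj : Function.Injective A := by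
    rw [injective_iff_map_eq_zero]
    intro x hx
    by_contra h0
    have := hpos x h0
    simp [hx] at this
  obtain ⟨a, rfl⟩ := LinearMap.injective_iff_surjective.mp hinj v
  have key := quadratic_nonneg_of_bilin ((innerₗ V).comp A) (T := L ∘ₗ A) (ε := ε) (l := l)
    (fun x y ↦ by simp [hA x y, real_inner_comm]) (fun x hx ↦ by simpa using hpos x hx)
    (fun x y ↦ by simp [hA _ _, hL _ _]) ?_ a
  · have : (A a + l • A (L (A a))) = A (a + l • L (A a)) := by simp
    rw [this, ← hA]
    simpa using key
  · intro μ x hx hμ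
    refine h μ (A x) ((map_ne_zero_iff A hinj).mpr hx) ?_
    rw [← map_smul, ← hμ]
    rfl

end Pencil

/-! ### Retractions onto the image of a map of constant rank -/

section ConstantRank

open Module

variable {E V : Type*} [NormedAddCommGroup E] [NormedSpace ℝ E]
  [NormedAddCommGroup V] [InnerProductSpace ℝ V] [FiniteDimensional ℝ V]

/-- Differentiating H∘f = f shows that DH is the identity on T, and H = H∘π shows that it factors
through the orthogonal projection π onto T. -/
theorem fderiv_retraction {T : Submodule ℝ V} {f : E → V} {H : V → V} {z : E}
    (hf : DifferentiableAt ℝ f z) (hH : DifferentiableAt ℝ H (f z))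
    (hHT : ∀ y, H (T.starProjection y) = H y) (hHf : ∀ᶠ z' in 𝓝 z, H (f z') = f z')
    (hT : (fderiv ℝ f z).range = T) :
    fderiv ℝ H (f z) = T.starProjection := by
  have h1 : HasFDerivAt f (fderiv ℝ H (f z) ∘L fderiv ℝ f z) z :=
    (hH.hasFDerivAt.comp z hf.hasFDerivAt).congr_of_eventuallyEq
      (hHf.mono fun _ h ↦ h.symm)
  have h2 : fderiv ℝ H (f z) ∘L fderiv ℝ f z = fderiv ℝ f z := h1.unique hf.hasFDerivAt
  have h3 : ∀ w ∈ T, fderiv ℝ H (f z) w = w := by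
    intro w hw
    rw [← hT] at hw
    obtain ⟨v, rfl⟩ := hw
    exact congrArg (fun l : E →L[ℝ] V ↦ l v) h2
  have h4 : ∀ y, HasDerivAt (fun t : ℝ ↦ H (f z + t • y)) (fderiv ℝ H (f z) y) 0 := by
    intro y
    have hd : HasDerivAt (fun t : ℝ ↦ f z + t • y) y 0 := by
      simpa using ((hasDerivAt_id (0 : ℝ)).smul_const y).const_add (f z)
    have hH' : HasFDerivAt H (fderiv ℝ H (f z)) (f z + (0 : ℝ) • y) := by
      simpa using hH.hasFDerivAt
    exact hH'.comp_hasDerivAt 0 hd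
  ext1 y
  rw [← h3 _ (T.starProjection_apply_mem y)]
  refine (h4 y).unique ((h4 (T.starProjection y)).congr_of_eventuallyEq ?_)
  refine Eventually.of_forall fun t ↦ ?_
  change H (f z + t • y) = H (f z + t • T.starProjection y)
  rw [← hHT (f z + t • y), ← hHT (f z + t • T.starProjection y)]
  simp only [map_add, map_smul]
  congr 3
  exact (Submodule.starProjection_eq_self_iff.mpr (T.starProjection_apply_mem y)).symm

theorem range_fderiv_eq_of_retraction {T : Submodule ℝ V} {f : E → V} {H : V → V} {z : E}
    (hf : DifferentiableAt ℝ f z) (hH : fderiv ℝ H (f z) = T.starProjection)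
    (hH' : DifferentiableAt ℝ H (f z)) (hHf : ∀ᶠ z' in 𝓝 z, H (f z') = f z')
    (hrank : finrank ℝ (fderiv ℝ f z).range = finrank ℝ T) :
    (fderiv ℝ f z).range = T := by
  refine Submodule.eq_of_le_of_finrank_eq ?_ hrank
  have h1 : HasFDerivAt f (fderiv ℝ H (f z) ∘L fderiv ℝ f z) z :=
    (hH'.hasFDerivAt.comp z hf.hasFDerivAt).congr_of_eventuallyEq
      (hHf.mono fun _ h ↦ h.symm)
  rintro _ ⟨v, rfl⟩
  have h2 : fderiv ℝ H (f z) (fderiv ℝ f z v) = fderiv ℝ f z v :=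
    congrArg (fun l : E →L[ℝ] V ↦ l v) (h1.unique hf.hasFDerivAt)
  rw [hH] at h2
  exact Submodule.starProjection_eq_self_iff.mp h2

/-- The right-hand side sees `v` and `w` only through their images under df, so the form belongs to
the image of f and to the chosen normal. The second derivative of f = H∘f is D²H(df v, df w) +
DH(d²f(v, w)), whose last term lies in T and is killed by N. Differentiating ⟨N, df w⟩ = 0 gives the
rest. -/
theorem inner_fderiv_normal_eq {T : Submodule ℝ V} {f N : E → V} {H : V → V} {z : E}
    (hf : ContDiffAt ℝ 2 f z) (hN : DifferentiableAt ℝ N z) (hH : ContDiffAt ℝ 2 H (f z))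
    (horth : ∀ᶠ z' in 𝓝 z, ∀ w, ⟪N z', fderiv ℝ f z' w⟫_ℝ = 0)
    (hHT : fderiv ℝ H (f z) = T.starProjection)
    (hHf : ∀ᶠ z' in 𝓝 z, H (f z') = f z')
    (hT : (fderiv ℝ f z).range = T) (v w : E) :
    ⟪fderiv ℝ N z v, fderiv ℝ f z w⟫_ℝ =
      -⟪N z, fderiv ℝ (fderiv ℝ H) (f z) (fderiv ℝ f z v) (fderiv ℝ f z w)⟫_ℝ := by
  have hf1 : DifferentiableAt ℝ f z := hf.differentiableAt (by simp)
  have hf2 : DifferentiableAt ℝ (fderiv ℝ f) z :=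
    (hf.fderiv_right (m := 1) (by norm_num)).differentiableAt (by simp)
  have hH2 : DifferentiableAt ℝ (fderiv ℝ H) (f z) :=
    (hH.fderiv_right (m := 1) (by norm_num)).differentiableAt (by simp)
  have hfw : HasFDerivAt (fun z' ↦ fderiv ℝ f z' w) ((fderiv ℝ (fderiv ℝ f) z).flip w) z := by
    have := HasFDerivAt.clm_apply (u := fun _ : E ↦ w) hf2.hasFDerivAt (hasFDerivAt_const w z)
    simpa using this
  have hcomp : (fun z' ↦ fderiv ℝ f z' w) =ᶠ[𝓝 z] fun z' ↦ fderiv ℝ H (f z') (fderiv ℝ f z' w) := by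
    have e1 : ∀ᶠ z' in 𝓝 z, DifferentiableAt ℝ f z' :=
      (hf.eventually (by simp)).mono fun _ h ↦ h.differentiableAt (by simp)
    have e2 : ∀ᶠ z' in 𝓝 z, DifferentiableAt ℝ H (f z') :=
      hf1.continuousAt.eventually ((hH.eventually (by simp)).mono
        fun _ h ↦ h.differentiableAt (by simp))
    filter_upwards [e1, e2, hHf.eventually_nhds] with z' h1 h2 h3
    have h4 : HasFDerivAt f (fderiv ℝ H (f z') ∘L fderiv ℝ f z') z' :=
      (h2.hasFDerivAt.comp z' h1.hasFDerivAt).congr_of_eventuallyEq (h3.mono fun _ h ↦ h.symm)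
    exact congrArg (fun l : E →L[ℝ] V ↦ l w) (h1.hasFDerivAt.unique h4)
  have hHw := (hH2.hasFDerivAt.comp z hf1.hasFDerivAt).clm_apply hfw
  have hsecond := congrArg (fun l : E →L[ℝ] V ↦ l v)
    (hfw.unique (hHw.congr_of_eventuallyEq hcomp))
  have hinner := congrArg (fun l : E →L[ℝ] ℝ ↦ l v)
    ((hN.hasFDerivAt.inner ℝ hfw).unique ((hasFDerivAt_const (0 : ℝ) z).congr_of_eventuallyEq
      (horth.mono fun z' h ↦ h w)))
  have hNT : ∀ y, ⟪N z, T.starProjection y⟫_ℝ = 0 := by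
    intro y
    obtain ⟨a, ha⟩ := hT.ge (T.starProjection_apply_mem y)
    rw [← ha]
    exact horth.self_of_nhds a
  simp only [Function.comp_apply, hHT] at hsecond
  simp at hsecond hinner
  rw [hsecond, inner_add_right, hNT] at hinner
  linarith

theorem hasFDerivAt_const_of_ker {T : Submodule ℝ V} {g : V → V} {c : V}
    (hc : T.starProjection c = c)
    (hg : ∀ᶠ y in 𝓝 c, DifferentiableAt ℝ g y ∧
      ∀ w, T.starProjection w = 0 → fderiv ℝ g y w = 0) :
    ∀ᶠ y in 𝓝 c, g y = g (T.starProjection y) := by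
  have hproj : ∀ y, T.starProjection (T.starProjection y) = T.starProjection y := fun y ↦
    Submodule.starProjection_eq_self_iff.mpr (T.starProjection_apply_mem y)
  obtain ⟨ε, hε, hball⟩ := Metric.eventually_nhds_iff_ball.mp hg
  filter_upwards [Metric.ball_mem_nhds c hε] with y hy
  -- The projection fixes `c` and does not increase norms, so the segment from the projection of `y`
  -- to `y` stays in the ball; `g` is constant on it.
  have hy' : T.starProjection y ∈ Metric.ball c ε := by
    rw [mem_ball_iff_norm] at hy ⊢
    have : T.starProjection y - c = T.starProjection (y - c) := by rw [map_sub, hc]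
    rw [this]
    exact (T.norm_starProjection_apply_le _).trans_lt hy
  let p : ℝ → V := fun t ↦ AffineMap.lineMap (T.starProjection y) y t
  have hp : ∀ t, HasDerivAt p (y - T.starProjection y) t := fun t ↦ AffineMap.hasDerivAt_lineMap
  have hpmem : ∀ t ∈ Set.Icc (0 : ℝ) 1, p t ∈ Metric.ball c ε := fun t ht ↦
    (convex_ball c ε).lineMap_mem hy' hy ht
  have hgp : ∀ t ∈ Set.Icc (0 : ℝ) 1, HasDerivAt (g ∘ p) 0 t := by
    intro t ht
    obtain ⟨hd, hk⟩ := hball _ (hpmem t ht)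
    have := hd.hasFDerivAt.comp_hasDerivAt t (hp t)
    rwa [hk _ (by rw [map_sub, hproj, sub_self])] at this
  have := constant_of_has_deriv_right_zero (f := g ∘ p) (a := 0) (b := 1)
    (fun t ht ↦ (hgp t ht).continuousAt.continuousWithinAt)
    (fun t ht ↦ (hgp t (Set.Ico_subset_Icc_self ht)).hasDerivWithinAt) 1 (by simp)
  simpa [p] using this

end ConstantRank

/-! ### Local inversion by tangential position and normal direction -/

section TubularChart

open Module

variable {E V : Type*} [NormedAddCommGroup E] [NormedSpace ℝ E]
  [NormedAddCommGroup V] [InnerProductSpace ℝ V]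

theorem inner_fderiv_of_norm_eq_one {N : E → V} {z : E} (hN : DifferentiableAt ℝ N z)
    (h1 : ∀ᶠ z' in 𝓝 z, ‖N z'‖ = 1) (v : E) : ⟪N z, fderiv ℝ N z v⟫_ℝ = 0 := by
  have h := (hN.hasFDerivAt.inner ℝ hN.hasFDerivAt).unique
    ((hasFDerivAt_const (1 : ℝ) z).congr_of_eventuallyEq (h1.mono fun z' hz ↦ by simp [hz]))
  have h2 := congrArg (fun l : E →L[ℝ] ℝ ↦ l v) h
  simp [real_inner_comm (N z)] at h2
  exact h2

/-- A map `f` together with a unit field `N` normal to it, near a point where the kernel of the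
differential of `f` is mapped injectively by the differential of `N` to normal directions. -/
structure IsTubular (f N : E → V) (z : E) : Prop where
  finrank_eq : finrank ℝ V = finrank ℝ E + 1
  smooth : ContDiffAt ℝ ∞ f z
  smooth_normal : ContDiffAt ℝ ∞ N z
  norm_normal : ∀ᶠ z' in 𝓝 z, ‖N z'‖ = 1
  normal : ∀ᶠ z' in 𝓝 z, ∀ w, ⟪N z', fderiv ℝ f z' w⟫_ℝ = 0
  finrank_range : ∀ᶠ z' in 𝓝 z,
    finrank ℝ (fderiv ℝ f z').range = finrank ℝ (fderiv ℝ f z).range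
  normal_of_ker : ∀ v, fderiv ℝ f z v = 0 → ∀ w, ⟪fderiv ℝ N z v, fderiv ℝ f z w⟫_ℝ = 0
  injective_of_ker : ∀ v, fderiv ℝ f z v = 0 → fderiv ℝ N z v = 0 → v = 0

variable {f N : E → V} {z : E}

variable [FiniteDimensional ℝ E] [FiniteDimensional ℝ V]

/-- The inverse function theorem for π f + (1 - π) N, taken modulo the line of N z to make the
dimensions agree. Working modulo that line produces the undetermined multiple `a • N z`. -/
theorem IsTubular.exists_localInverse (h : IsTubular f N z) {T : Submodule ℝ V}
    (hT : (fderiv ℝ f z).range = T) :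
    ∃ Ψ : V → E, ContDiffAt ℝ ∞ Ψ (T.starProjection (f z)) ∧ Ψ (T.starProjection (f z)) = z ∧
      (∀ᶠ z' in 𝓝 z, Ψ (T.starProjection (f z') + (N z' - T.starProjection (N z')) - N z) = z') ∧
      (∀ᶠ y in 𝓝 (T.starProjection (f z)), T.starProjection (f (Ψ y)) = T.starProjection y) ∧
      ∀ᶠ y in 𝓝 (T.starProjection (f z)), ∃ a : ℝ,
        N (Ψ y) - T.starProjection (N (Ψ y)) = y - T.starProjection y + a • N z := by
  have hproj : ∀ y, T.starProjection (T.starProjection y) = T.starProjection y := fun y ↦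
    Submodule.starProjection_eq_self_iff.mpr (T.starProjection_apply_mem y)
  have hu : ‖N z‖ = 1 := h.norm_normal.self_of_nhds
  have hu0 : N z ≠ 0 := norm_ne_zero_iff.mp (by rw [hu]; exact one_ne_zero)
  have hTu : N z ∈ Tᗮ := by
    rw [Submodule.mem_orthogonal']
    intro y hy
    obtain ⟨w, rfl⟩ := hT.ge hy
    exact h.normal.self_of_nhds w
  have hπu : T.starProjection (N z) = 0 := T.starProjection_apply_eq_zero_iff.mpr hTu
  let K : Submodule ℝ V := (ℝ ∙ N z)ᗮ
  let p : V →L[ℝ] K := K.orthogonalProjectionOnto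
  have hpu : p (N z) = 0 := by
    refine Submodule.orthogonalProjectionOnto_eq_zero_iff.mpr ?_
    exact Submodule.le_orthogonal_orthogonal _ (Submodule.mem_span_singleton_self _)
  have hpK : ∀ y, p y = 0 ↔ ∃ a : ℝ, y = a • N z := by
    intro y
    rw [Submodule.orthogonalProjectionOnto_eq_zero_iff, Submodule.orthogonal_orthogonal,
      Submodule.mem_span_singleton]
    exact ⟨fun ⟨a, ha⟩ ↦ ⟨a, ha.symm⟩, fun ⟨a, ha⟩ ↦ ⟨a, ha.symm⟩⟩
  let q : V →L[ℝ] V := ContinuousLinearMap.id ℝ V - T.starProjection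
  let Θ : E → K := fun z' ↦ p (T.starProjection (f z') + q (N z'))
  have hf1 := (h.smooth.differentiableAt (by simp)).hasFDerivAt
  have hN1 := (h.smooth_normal.differentiableAt (by simp)).hasFDerivAt
  have hΘ : HasFDerivAt Θ
      (p ∘L (T.starProjection ∘L fderiv ℝ f z + q ∘L fderiv ℝ N z)) z :=
    p.hasFDerivAt.comp z ((T.starProjection.hasFDerivAt.comp z hf1).add
      (q.hasFDerivAt.comp z hN1))
  have hΘs : ContDiffAt ℝ ∞ Θ z :=
    p.contDiff.contDiffAt.comp z ((T.starProjection.contDiff.contDiffAt.comp z h.smooth).add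
      (q.contDiff.contDiffAt.comp z h.smooth_normal))
  have hinj : Function.Injective
      (p ∘L (T.starProjection ∘L fderiv ℝ f z + q ∘L fderiv ℝ N z)) := by
    rw [injective_iff_map_eq_zero]
    intro v hv
    obtain ⟨a, ha⟩ := (hpK _).mp hv
    -- The T-component forces df v = 0. Then dN v is normal to T and parallel to N z, but also
    -- orthogonal to N z because N has unit length, so it vanishes.
    have h1 : fderiv ℝ f z v = 0 := by
      have h2 := congrArg T.starProjection ha
      have hm : fderiv ℝ f z v ∈ T := hT.le ⟨v, rfl⟩
      simpa [q, hproj, hπu, Submodule.starProjection_eq_self_iff.mpr hm] using h2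
    have h3 : T.starProjection (fderiv ℝ N z v) = 0 := by
      rw [T.starProjection_apply_eq_zero_iff, Submodule.mem_orthogonal']
      intro y hy
      obtain ⟨w, rfl⟩ := hT.ge hy
      exact h.normal_of_ker v h1 w
    have h4 : fderiv ℝ N z v = a • N z := by simpa [q, h1, h3] using ha
    have h5 := inner_fderiv_of_norm_eq_one hN1.differentiableAt h.norm_normal v
    rw [h4, inner_smul_right, real_inner_self_eq_norm_sq, hu] at h5
    refine h.injective_of_ker v h1 ?_
    rw [h4, show a = 0 by simpa using h5, zero_smul]
  have hfin : finrank ℝ E = finrank ℝ K := by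
    have : Fact (finrank ℝ V = finrank ℝ E + 1) := ⟨h.finrank_eq⟩
    exact (Submodule.finrank_orthogonal_span_singleton hu0).symm
  let e : E ≃L[ℝ] K := (LinearEquiv.ofInjectiveOfFinrankEq _ hinj hfin).toContinuousLinearEquiv
  have hΘe : HasFDerivAt Θ (e : E →L[ℝ] K) z := by
    exact hΘ
  have hΘz : Θ z = p (T.starProjection (f z)) := by
    simp [Θ, q, hπu, hpu]
  have hstrict := hΘs.hasStrictFDerivAt' hΘe (by simp)
  have hpc : Tendsto p (𝓝 (T.starProjection (f z))) (𝓝 (Θ z)) := by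
    rw [hΘz]
    exact p.continuous.continuousAt
  have hright := hpc.eventually hstrict.eventually_right_inverse
  have hdiff : ∀ᶠ y in 𝓝 (T.starProjection (f z)), ∃ a : ℝ,
      T.starProjection (f (hstrict.localInverse Θ e z (p y))) +
        q (N (hstrict.localInverse Θ e z (p y))) = y + a • N z := by
    filter_upwards [hright] with y hy
    have : p (T.starProjection (f (hstrict.localInverse Θ e z (p y))) +
        q (N (hstrict.localInverse Θ e z (p y))) - y) = 0 := by
      rw [map_sub, sub_eq_zero]
      exact hy
    obtain ⟨a, ha⟩ := (hpK _).mp this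
    exact ⟨a, by rw [← ha]; abel⟩
  refine ⟨fun y ↦ hstrict.localInverse Θ e z (p y), ?_, ?_, ?_, ?_, ?_⟩
  · have h1 := hΘs.to_localInverse hΘe (by simp)
    rw [hΘz] at h1
    exact h1.comp (T.starProjection (f z)) p.contDiff.contDiffAt
  · change hstrict.localInverse Θ e z (p (T.starProjection (f z))) = z
    rw [← hΘz]
    exact hstrict.localInverse_apply_image
  · filter_upwards [hstrict.eventually_left_inverse] with z' hz'
    rw [map_sub, hpu, sub_zero]
    exact hz'
  · filter_upwards [hdiff] with y ⟨a, ha⟩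
    have := congrArg T.starProjection ha
    simpa [q, hproj, hπu] using this
  · filter_upwards [hdiff] with y ⟨a, ha⟩
    refine ⟨a, ?_⟩
    have h1 : T.starProjection (f (hstrict.localInverse Θ e z (p y))) = T.starProjection y := by
      have := congrArg T.starProjection ha
      simpa [q, hproj, hπu] using this
    rw [h1] at ha
    have h2 : q (N (hstrict.localInverse Θ e z (p y))) = y - T.starProjection y + a • N z := by
      rw [sub_add_eq_add_sub, ← ha]
      abel
    exact h2

/-- The constant rank theorem, with the fibre described by its normals: f∘Ψ depends only on the
T-component, so varying the other component of the argument moves along a fibre of f. -/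
theorem IsTubular.exists_section (h : IsTubular f N z) {T : Submodule ℝ V}
    (hT : (fderiv ℝ f z).range = T) :
    ∃ Ψ : V → E, ContDiffAt ℝ ∞ Ψ (T.starProjection (f z)) ∧ Ψ (T.starProjection (f z)) = z ∧
      (∀ᶠ y in 𝓝 (f z), T.starProjection (f (Ψ (T.starProjection y))) = T.starProjection y) ∧
      (∀ᶠ z' in 𝓝 z, f (Ψ (T.starProjection (f z'))) = f z') ∧
      ∀ᶠ m in 𝓝 (N z), ‖m‖ = 1 → m ∈ Tᗮ →
        f (Ψ (T.starProjection (f z) + (m - N z))) = f z ∧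
          N (Ψ (T.starProjection (f z) + (m - N z))) = m := by
  obtain ⟨Ψ, hΨ, hΨz, hleft, hpf, hN⟩ := h.exists_localInverse hT
  have hproj : ∀ y, T.starProjection (T.starProjection y) = T.starProjection y := fun y ↦
    Submodule.starProjection_eq_self_iff.mpr (T.starProjection_apply_mem y)
  have hTorth : ∀ y, y ∈ Tᗮ → T.starProjection y = 0 := fun y hy ↦
    T.starProjection_apply_eq_zero_iff.mpr hy
  have hTu : N z ∈ Tᗮ := by
    rw [Submodule.mem_orthogonal']
    intro y hy
    obtain ⟨w, rfl⟩ := hT.ge hy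
    exact h.normal.self_of_nhds w
  set c := T.starProjection (f z) with hc
  have hΨc : Tendsto Ψ (𝓝 c) (𝓝 z) := by
    have := hΨ.continuousAt.tendsto
    rwa [hΨz] at this
  have hπc : Tendsto T.starProjection (𝓝 (f z)) (𝓝 c) := T.starProjection.continuous.continuousAt
  have hfd : ∀ᶠ z' in 𝓝 z, DifferentiableAt ℝ f z' :=
    ((h.smooth.of_le (m := 1) (by simp)).eventually (by simp)).mono
      fun _ h ↦ h.differentiableAt (by simp)
  have hΨd : ∀ᶠ y in 𝓝 c, DifferentiableAt ℝ Ψ y :=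
    ((hΨ.of_le (m := 1) (by simp)).eventually (by simp)).mono
      fun _ h ↦ h.differentiableAt (by simp)
  have hconst : ∀ᶠ y in 𝓝 c, f (Ψ y) = f (Ψ (T.starProjection y)) := by
    refine hasFDerivAt_const_of_ker (g := fun y ↦ f (Ψ y)) (hproj _) ?_
    filter_upwards [hΨc.eventually hfd, hΨd, hΨc.eventually h.finrank_range,
      hpf.eventually_nhds] with y h1 h2 h3 h4
    have hg : HasFDerivAt (fun y ↦ f (Ψ y)) (fderiv ℝ f (Ψ y) ∘L fderiv ℝ Ψ y) y :=
      h1.hasFDerivAt.comp y h2.hasFDerivAt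
    have hπg : T.starProjection ∘L (fderiv ℝ f (Ψ y) ∘L fderiv ℝ Ψ y) = T.starProjection :=
      (T.starProjection.hasFDerivAt.comp y hg).unique
        (T.starProjection.hasFDerivAt.congr_of_eventuallyEq h4)
    refine ⟨hg.differentiableAt, fun w hw ↦ ?_⟩
    rw [hg.fderiv]
    -- The projection maps this range onto T, and the ranks agree, so it is injective there. A
    -- vector killed by the projection is therefore killed by the differential of f∘Ψ.
    let R := (fderiv ℝ f (Ψ y)).range
    let P : R →ₗ[ℝ] T := (T.orthogonalProjectionOnto : V →ₗ[ℝ] T).comp R.subtype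
    have hPsurj : Function.Surjective P := by
      intro t
      refine ⟨⟨fderiv ℝ f (Ψ y) (fderiv ℝ Ψ y t), ⟨_, rfl⟩⟩, ?_⟩
      ext1
      have := congrArg (fun l : V →L[ℝ] V ↦ l t) hπg
      simp only [ContinuousLinearMap.comp_apply,
        Submodule.starProjection_eq_self_iff.mpr t.2] at this
      exact this
    have hPinj : Function.Injective P :=
      (LinearMap.injective_iff_surjective_of_finrank_eq_finrank (by rw [h3, hT])).mpr hPsurj
    have hw' : P ⟨fderiv ℝ f (Ψ y) (fderiv ℝ Ψ y w), ⟨_, rfl⟩⟩ = 0 := by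
      ext1
      have := congrArg (fun l : V →L[ℝ] V ↦ l w) hπg
      simp only [ContinuousLinearMap.comp_apply, hw] at this
      exact this
    exact congrArg Subtype.val ((map_eq_zero_iff P hPinj).mp hw')
  have hret : ∀ᶠ z' in 𝓝 z, f (Ψ (T.starProjection (f z'))) = f z' := by
    have hcont : Tendsto (fun z' ↦ T.starProjection (f z') + (N z' - T.starProjection (N z')) - N z)
        (𝓝 z) (𝓝 c) := by
      have h1 : ContinuousAt
          (fun z' ↦ T.starProjection (f z') + (N z' - T.starProjection (N z')) - N z) z :=
        ((T.starProjection.continuous.continuousAt.comp h.smooth.continuousAt).add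
          (h.smooth_normal.continuousAt.sub
            (T.starProjection.continuous.continuousAt.comp h.smooth_normal.continuousAt))).sub continuousAt_const
      have h2 := h1.tendsto
      rwa [hTorth _ hTu, sub_zero, add_sub_cancel_right] at h2
    filter_upwards [hcont.eventually hconst, hleft] with z' h1 h2
    rw [h2] at h1
    simp only [map_add, map_sub, hproj, sub_self, add_zero, hTorth _ hTu, sub_zero] at h1
    exact h1.symm
  refine ⟨Ψ, hΨ, hΨz, ?_, hret, ?_⟩
  · filter_upwards [hπc.eventually hpf] with y hy
    rw [hy, hproj]
  have hcurve : Tendsto (fun m ↦ c + (m - N z)) (𝓝 (N z)) (𝓝 c) := by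
    have : Continuous fun m ↦ c + (m - N z) := by fun_prop
    simpa using this.tendsto (N z)
  have hfc : f (Ψ c) = f z := by rw [hΨz]
  have hHd : DifferentiableAt ℝ (fun y ↦ f (Ψ (T.starProjection y))) (f z) := by
    have h1 : ContDiffAt ℝ ∞ f (Ψ c) := by rw [hΨz]; exact h.smooth
    exact ((h1.comp c hΨ).comp (f z)
      T.starProjection.contDiff.contDiffAt).differentiableAt (by simp)
  have hHder := fderiv_retraction (h.smooth.differentiableAt (by simp)) hHd
    (fun y ↦ by simp only [hproj]) hret hT
  have hΨm := hΨc.comp hcurve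
  have hu : ‖N z‖ = 1 := h.norm_normal.self_of_nhds
  have hpos1 : ∀ᶠ m in 𝓝 (N z), 0 < ⟪m, N z⟫_ℝ :=
    (continuous_id.inner continuous_const).continuousAt.eventually
      (lt_mem_nhds (by simp [hu]))
  have hpos2 : ∀ᶠ z' in 𝓝 z, 0 < ⟪N z', N z⟫_ℝ :=
    (h.smooth_normal.continuousAt.inner continuousAt_const).eventually
      (lt_mem_nhds (by simp [hu]))
  filter_upwards [hcurve.eventually hconst, hcurve.eventually hN, hΨm.eventually hfd,
    hΨm.eventually h.finrank_range, hΨm.eventually h.norm_normal, hΨm.eventually h.normal,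
    hΨm.eventually hret.eventually_nhds, hpos1, hΨm.eventually hpos2]
    with m h1 h2 h3 h4 h5 h6 h7 h8 h9 hm1 hmT
  have hπ : T.starProjection (c + (m - N z)) = c := by
    rw [map_add, map_sub, hTorth _ hmT, hTorth _ hTu, sub_zero, add_zero, hc, hproj]
  rw [hπ, hfc] at h1
  refine ⟨h1, ?_⟩
  simp only [Function.comp_apply] at h3 h4 h5 h6 h7 h9
  set z' := Ψ (c + (m - N z))
  have hrange : (fderiv ℝ f z').range = T :=
    range_fderiv_eq_of_retraction h3 (by rw [h1]; exact hHder) (by rw [h1]; exact hHd) h7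
      (by rw [h4, hT])
  have hNT : N z' ∈ Tᗮ := by
    rw [Submodule.mem_orthogonal']
    intro y hy
    obtain ⟨w, rfl⟩ := hrange.ge hy
    exact h6 w
  obtain ⟨a, ha⟩ := h2
  rw [hπ, hTorth _ hNT, sub_zero, add_sub_cancel_left, sub_add] at ha
  have hb : N z' = m + (a - 1) • N z := by rw [ha]; module
  have hsq : ‖N z'‖ ^ 2 = 1 := by rw [h5]; norm_num
  rw [hb, norm_add_sq_real, norm_smul, hm1, hu, inner_smul_right, mul_one, Real.norm_eq_abs,
    sq_abs] at hsq
  rw [hb, inner_add_left, inner_smul_left, real_inner_self_eq_norm_sq, hu] at h9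
  simp only [conj_trivial] at h9
  -- Both N z' and m are unit vectors differing by a multiple of N z. The root a ≠ 1 would be the
  -- reflection of m in the hyperplane orthogonal to N z, which is excluded since both have positive
  -- inner product with N z.
  have hzero : (a - 1) * (2 * ⟪m, N z⟫_ℝ + (a - 1)) = 0 := by linarith
  rcases mul_eq_zero.mp hzero with h0 | h0
  · rw [hb, h0, zero_smul, add_zero]
  · linarith

end TubularChart

/-! ### Continuation in a complete space -/

section Continuation

open scoped ENNReal NNReal

/-- Zorn's lemma on the points of S, ordered by time together with the Lipschitz bound. Along a
chain the positions are Lipschitz in time, hence converge as the time tends to its supremum;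
closedness keeps the limit in S, and `hext` forces a maximal element to have time `b`. -/
theorem exists_mem_of_lipschitz_continuation {X : Type*} [EMetricSpace X] [CompleteSpace X]
    {S : Set (ℝ × X)} (hS : IsClosed S) (C : ℝ≥0) {b : ℝ} (hb : 0 ≤ b) {p : X}
    (hp : (0, p) ∈ S)
    (hext : ∀ t q, (t, q) ∈ S → 0 ≤ t → t < b →
      ∃ t' ∈ Set.Ioc t b, ∃ q', (t', q') ∈ S ∧ edist q q' ≤ C * edist t t') :
    ∃ q, (b, q) ∈ S := by
  let A : Type _ := {z : ℝ × X // z ∈ S ∧ 0 ≤ z.1 ∧ z.1 ≤ b}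
  let r : A → A → Prop := fun z z' ↦
    z.1.1 ≤ z'.1.1 ∧ edist z.1.2 z'.1.2 ≤ C * edist z.1.1 z'.1.1
  have : Nonempty A := ⟨⟨(0, p), hp, le_rfl, hb⟩⟩
  suffices h : (∀ c : Set A, IsChain r c → c.Nonempty → ∃ ub, ∀ a ∈ c, r a ub) ∧
      ∀ {x y z : A}, r x y → r y z → r x z by
    obtain ⟨m, hm⟩ := exists_maximal_of_nonempty_chains_bounded (r := r) h.1 h.2
    obtain ⟨⟨t, q⟩, hmS, hm0, hmb⟩ := m
    rcases hmb.eq_or_lt with h | h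
    · simp only at h
      exact ⟨q, h ▸ hmS⟩
    · obtain ⟨t', ht', q', hq', hd⟩ := hext t q hmS hm0 h
      have := (hm ⟨(t', q'), hq', hm0.trans ht'.1.le, ht'.2⟩ ⟨ht'.1.le, hd⟩).1
      exact absurd ht'.1 (not_lt.mpr this)
  refine ⟨?_, ?_⟩
  · intro c hc hne
    have hlip : ∀ z ∈ c, ∀ z' ∈ c, edist z.1.2 z'.1.2 ≤ C * edist z.1.1 z'.1.1 := by
      intro z hz z' hz'
      by_cases h : z = z'
      · simp [h]
      · rcases hc hz hz' h with h | h
        · exact h.2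
        · rw [edist_comm z.1.2, edist_comm z.1.1]
          exact h.2
    let I : Set ℝ := (fun z : A ↦ z.1.1) '' c
    have hI : BddAbove I := ⟨b, by rintro _ ⟨z, -, rfl⟩; exact z.2.2.2⟩
    obtain ⟨u, -, hu, huI⟩ := exists_seq_tendsto_sSup (hne.image _ : I.Nonempty) hI
    choose z hzc hzu using huI
    have hcauchy : CauchySeq fun k ↦ (z k).1.2 := by
      -- Points of a chain with equal times coincide by the Lipschitz bound, so the chain is the
      -- graph of a Lipschitz function `g` on its set of times.
      have hclass : ∀ s : ℝ, ∃ x : X, s ∈ I → ∃ z ∈ c, z.1 = (s, x) := by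
        intro s
        by_cases hs : s ∈ I
        · obtain ⟨z, hz, rfl⟩ := hs
          exact ⟨z.1.2, fun _ ↦ ⟨z, hz, rfl⟩⟩
        · exact ⟨p, fun h ↦ absurd h hs⟩
      choose g hg using hclass
      have hgl : LipschitzOnWith C g I := by
        intro s hs s' hs'
        obtain ⟨z, hz, hzs⟩ := hg s hs
        obtain ⟨z', hz', hzs'⟩ := hg s' hs'
        simpa [hzs, hzs'] using hlip z hz z' hz'
      have hmem : ∀ k, u k ∈ I := fun k ↦ ⟨z k, hzc k, hzu k⟩
      have hgz : (fun k ↦ (z k).1.2) = g ∘ u := by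
        funext k
        obtain ⟨z', hz', hzs'⟩ := hg (u k) (hmem k)
        have h1 := hlip (z k) (hzc k) z' hz'
        have h2 : (z k).1.1 = u k := hzu k
        rw [hzs', h2] at h1
        simpa using h1
      rw [hgz, CauchySeq, ← Filter.map_map]
      exact hu.cauchySeq.map_of_le hgl.uniformContinuousOn
        (le_principal_iff.mpr (mem_map.mpr (univ_mem' hmem)))
    obtain ⟨q, hq⟩ := cauchySeq_tendsto_of_complete hcauchy
    have hz1 : Tendsto (fun k ↦ (z k).1.1) atTop (𝓝 (sSup I)) := by
      simpa only [hzu] using hu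
    have hmemS : (sSup I, q) ∈ S :=
      hS.mem_of_tendsto (hz1.prodMk_nhds hq) (Eventually.of_forall fun k ↦ (z k).2.1)
    refine ⟨⟨(sSup I, q), hmemS, ?_, ?_⟩, fun a ha ↦ ⟨le_csSup hI ⟨a, ha, rfl⟩, ?_⟩⟩
    · exact ge_of_tendsto' hz1 fun k ↦ (z k).2.2.1
    · exact le_of_tendsto' hz1 fun k ↦ (z k).2.2.2
    · refine le_of_tendsto_of_tendsto' (tendsto_const_nhds.edist hq)
        (ENNReal.Tendsto.const_mul (tendsto_const_nhds.edist hz1) (Or.inr ENNReal.coe_ne_top))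
        fun k ↦ hlip a ha (z k) (hzc k)
  · intro x y z hxy hyz
    refine ⟨hxy.1.trans hyz.1, (edist_triangle _ y.1.2 _).trans
      ((add_le_add hxy.2 hyz.2).trans ?_)⟩
    rw [← mul_add]
    gcongr
    rw [edist_dist, edist_dist, edist_dist, ← ENNReal.ofReal_add dist_nonneg dist_nonneg]
    refine ENNReal.ofReal_le_ofReal (le_of_eq ?_)
    rw [Real.dist_eq, Real.dist_eq, Real.dist_eq, abs_of_nonpos (sub_nonpos.mpr hxy.1),
      abs_of_nonpos (sub_nonpos.mpr hyz.1), abs_of_nonpos (sub_nonpos.mpr (hxy.1.trans hyz.1))]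
    ring

end Continuation

/-! ### Sign and symmetry of the focal form -/

section FocalForm

open Module

/-- Identifying E with u^⊥ through `dx` turns `dN` into a symmetric operator L, and `pencil_nonneg`
applies to L and the restriction of `A`. -/
theorem focalForm_nonneg {E V : Type*} [AddCommGroup E] [Module ℝ E] [FiniteDimensional ℝ E]
    [NormedAddCommGroup V] [InnerProductSpace ℝ V] [FiniteDimensional ℝ V]
    (hdim : finrank ℝ V = finrank ℝ E + 1) {dx dN : E →ₗ[ℝ] V} {A : V →ₗ[ℝ] V} {u : V}
    (hu : ‖u‖ = 1) (hinj : Function.Injective dx) (hx : ∀ v, ⟪u, dx v⟫_ℝ = 0)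
    (hN : ∀ v, ⟪u, dN v⟫_ℝ = 0) (hsymm : ∀ v w, ⟪dN v, dx w⟫_ℝ = ⟪dN w, dx v⟫_ℝ)
    (hAu : ∀ v, ⟪u, v⟫_ℝ = 0 → ⟪u, A v⟫_ℝ = 0)
    (hA : ∀ v w, ⟪u, v⟫_ℝ = 0 → ⟪u, w⟫_ℝ = 0 → ⟪A v, w⟫_ℝ = ⟪v, A w⟫_ℝ)
    (hpos : ∀ v, ⟪u, v⟫_ℝ = 0 → v ≠ 0 → 0 < ⟪A v, v⟫_ℝ) {ε l : ℝ}
    (h : ∀ (μ : ℝ) (v : E), v ≠ 0 → A (dN v) = μ • dx v → 0 ≤ ε * (μ * (1 + l * μ))) (v : E) :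
    0 ≤ ε * ⟪dN v, dx v + l • A (dN v)⟫_ℝ := by
  have hu0 : u ≠ 0 := norm_ne_zero_iff.mp (by rw [hu]; exact one_ne_zero)
  let K : Submodule ℝ V := (ℝ ∙ u)ᗮ
  have hK : ∀ y, y ∈ K ↔ ⟪u, y⟫_ℝ = 0 := fun y ↦ Submodule.mem_orthogonal_singleton_iff_inner_right
  have hfin : finrank ℝ E = finrank ℝ K := by
    have : Fact (finrank ℝ V = finrank ℝ E + 1) := ⟨hdim⟩
    exact (Submodule.finrank_orthogonal_span_singleton hu0).symm
  let D : E ≃ₗ[ℝ] K := LinearEquiv.ofInjectiveOfFinrankEq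
    (dx.codRestrict K fun v ↦ (hK _).mpr (hx v))
    (fun a b hab ↦ hinj (congrArg Subtype.val hab)) hfin
  have hD : ∀ v, (D v : V) = dx v := fun v ↦ rfl
  let A' : K →ₗ[ℝ] K := A.restrict (p := K) (q := K) fun y hy ↦ (hK _).mpr (hAu y ((hK _).mp hy))
  let N' : E →ₗ[ℝ] K := dN.codRestrict K fun v ↦ (hK _).mpr (hN v)
  let L : K →ₗ[ℝ] K := N' ∘ₗ D.symm.toLinearMap
  have key := pencil_nonneg (A := A') (L := L) (ε := ε) (l := l)
    (fun a b ↦ hA a b ((hK _).mp a.2) ((hK _).mp b.2))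
    (fun a ha ↦ hpos a ((hK _).mp a.2) fun h0 ↦ ha (Subtype.ext h0)) ?_ ?_ (D v)
  · have hL : L (D v) = N' v := by simp [L]
    rw [hL] at key
    exact key
  · intro a b
    obtain ⟨a, rfl⟩ := D.surjective a
    obtain ⟨b, rfl⟩ := D.surjective b
    have hL : ∀ v, L (D v) = N' v := fun v ↦ by simp [L]
    rw [hL, hL, real_inner_comm]
    change ⟪dx b, dN a⟫_ℝ = ⟪dx a, dN b⟫_ℝ
    rw [real_inner_comm, hsymm, real_inner_comm]
  · intro μ a ha hμ
    obtain ⟨a, rfl⟩ := D.surjective a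
    have hL : L (D a) = N' a := by simp [L]
    rw [hL] at hμ
    exact h μ a (fun h0 ↦ ha (by rw [h0, map_zero])) (congrArg Subtype.val hμ)

theorem inner_fderiv_normal_symm {E V : Type*} [NormedAddCommGroup E] [NormedSpace ℝ E]
    [NormedAddCommGroup V] [InnerProductSpace ℝ V] {f N : E → V} {z : E}
    (hf : ContDiffAt ℝ 2 f z) (hN : DifferentiableAt ℝ N z)
    (horth : ∀ᶠ z' in 𝓝 z, ∀ w, ⟪N z', fderiv ℝ f z' w⟫_ℝ = 0) (v w : E) :
    ⟪fderiv ℝ N z v, fderiv ℝ f z w⟫_ℝ = ⟪fderiv ℝ N z w, fderiv ℝ f z v⟫_ℝ := by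
  have hf2 : DifferentiableAt ℝ (fderiv ℝ f) z :=
    (hf.fderiv_right (m := 1) (by norm_num)).differentiableAt (by simp)
  have key : ∀ v w, ⟪fderiv ℝ N z v, fderiv ℝ f z w⟫_ℝ =
      -⟪N z, fderiv ℝ (fderiv ℝ f) z v w⟫_ℝ := by
    intro v w
    have hfw : HasFDerivAt (fun z' ↦ fderiv ℝ f z' w) ((fderiv ℝ (fderiv ℝ f) z).flip w) z := by
      have := HasFDerivAt.clm_apply (u := fun _ : E ↦ w) hf2.hasFDerivAt (hasFDerivAt_const w z)
      simpa using this
    have hinner := congrArg (fun l : E →L[ℝ] ℝ ↦ l v)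
      ((hN.hasFDerivAt.inner ℝ hfw).unique ((hasFDerivAt_const (0 : ℝ) z).congr_of_eventuallyEq
        (horth.mono fun z' h ↦ h w)))
    simp at hinner
    linarith
  rw [key, key, hf.isSymmSndFDerivAt (by simp) v w]

end FocalForm

/-! ### Differentials read in charts -/

section Chart

variable {n : ℕ} {M : Type*} [TopologicalSpace M] [ChartedSpace (EuclideanSpace ℝ (Fin n)) M]
  {g : M → Ambient n}

theorem differential_eq_fderiv (hg : ContMDiff (𝓡 n) 𝓘(ℝ, Ambient n) ∞ g) (q : M)
    (v : EuclideanSpace ℝ (Fin n)) :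
    differential g q v =
      fderiv ℝ (g ∘ (extChartAt (𝓡 n) q).symm) (extChartAt (𝓡 n) q q) v := by
  have h : MDifferentiableAt (𝓡 n) 𝓘(ℝ, Ambient n) g q := hg.mdifferentiableAt (by simp)
  have h2 : mfderiv (𝓡 n) 𝓘(ℝ, Ambient n) g q =
      fderiv ℝ (g ∘ (extChartAt (𝓡 n) q).symm) (extChartAt (𝓡 n) q q) := by
    rw [h.mfderiv, modelWithCornersSelf_coe, Set.range_id, fderivWithin_univ]
    rfl
  exact congrArg (fun l : EuclideanSpace ℝ (Fin n) →L[ℝ] Ambient n ↦ l v) h2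

variable [IsManifold (𝓡 n) ∞ M]

theorem contDiffAt_comp_extChartAt_symm (hg : ContMDiff (𝓡 n) 𝓘(ℝ, Ambient n) ∞ g) (q : M)
    {z : EuclideanSpace ℝ (Fin n)} (hz : z ∈ (extChartAt (𝓡 n) q).target) :
    ContDiffAt ℝ ∞ (g ∘ (extChartAt (𝓡 n) q).symm) z := by
  have h := hg.comp_contMDiffOn (contMDiffOn_extChartAt_symm (I := 𝓡 n) (n := ∞) q)
  exact (h.contMDiffAt ((isOpen_extChartAt_target q).mem_nhds hz)).contDiffAt

/-- One isomorphism J serves all maps g, so linear relations between the differentials of x, ν and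
the focal map transfer together to points of the chart other than its centre. -/
theorem exists_fderiv_eq_differential_comp (q : M) {z : EuclideanSpace ℝ (Fin n)}
    (hz : z ∈ (extChartAt (𝓡 n) q).target) :
    ∃ J : EuclideanSpace ℝ (Fin n) ≃L[ℝ]
        TangentSpace (𝓡 n) ((extChartAt (𝓡 n) q).symm z),
      ∀ g : M → Ambient n, ContMDiff (𝓡 n) 𝓘(ℝ, Ambient n) ∞ g → ∀ v,
        fderiv ℝ (g ∘ (extChartAt (𝓡 n) q).symm) z v =
          differential g ((extChartAt (𝓡 n) q).symm z) (J v) := by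
  obtain ⟨J, hJ⟩ := isInvertible_mfderivWithin_extChartAt_symm (I := 𝓡 n) hz
  refine ⟨J, fun g hg v ↦ ?_⟩
  have h1 : MDifferentiableAt (𝓡 n) 𝓘(ℝ, Ambient n) g ((extChartAt (𝓡 n) q).symm z) :=
    hg.mdifferentiableAt (by simp)
  have h2 : MDifferentiableAt 𝓘(ℝ, EuclideanSpace ℝ (Fin n)) (𝓡 n)
      (extChartAt (𝓡 n) q).symm z :=
    ((contMDiffOn_extChartAt_symm (I := 𝓡 n) (n := ∞) q).contMDiffAt
      ((isOpen_extChartAt_target q).mem_nhds hz)).mdifferentiableAt (by simp)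
  have h3 := mfderiv_comp z h1 h2
  rw [mfderiv_eq_fderiv] at h3
  rw [h3, differential]
  simp only [modelWithCornersSelf_coe, Set.range_id, mfderivWithin_univ] at hJ
  change mfderiv (𝓡 n) 𝓘(ℝ, Ambient n) g _ (mfderiv _ (𝓡 n) (extChartAt (𝓡 n) q).symm z v) = _
  rw [← hJ]
  rfl

end Chart

/-! ### The focal map of a hypersurface -/

section Hypersurface

open Module

variable {n : ℕ} {F : UnitSphere n → ℝ} {M : Type*} {x : M → Ambient n} {ν : M → UnitSphere n}

/-- The Gauss map, as a map to the ambient space. -/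
noncomputable def gaussVector (ν : M → UnitSphere n) (q : M) : Ambient n := ν q

/-- The focal map `x + l⁻¹ φ ∘ ν`. -/
noncomputable def focalMap (F : UnitSphere n → ℝ) (x : M → Ambient n) (ν : M → UnitSphere n)
    (l : ℝ) (q : M) : Ambient n :=
  x q + l⁻¹ • wulffMap F (ν q)

theorem norm_gaussVector (ν : M → UnitSphere n) (q : M) : ‖gaussVector ν q‖ = 1 := by
  simp [gaussVector]

theorem gaussVector_ne_zero (ν : M → UnitSphere n) (q : M) : gaussVector ν q ≠ 0 :=
  norm_ne_zero_iff.mp (by rw [norm_gaussVector]; exact one_ne_zero)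

variable [TopologicalSpace M] [ChartedSpace (EuclideanSpace ℝ (Fin n)) M]

theorem contMDiff_gaussVector (hν : ContMDiff (𝓡 n) (𝓡 n) ∞ ν) :
    ContMDiff (𝓡 n) 𝓘(ℝ, Ambient n) ∞ (gaussVector ν) := by
  have : Fact (finrank ℝ (Ambient n) = n + 1) := ⟨by simp⟩
  exact (contMDiff_coe_sphere (E := Ambient n) (n := n)).comp hν

theorem contMDiff_wulffMap_comp (hF : ContMDiff (𝓡 n) 𝓘(ℝ, ℝ) ∞ F)
    (hν : ContMDiff (𝓡 n) (𝓡 n) ∞ ν) :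
    ContMDiff (𝓡 n) 𝓘(ℝ, Ambient n) ∞ fun q ↦ wulffMap F (ν q) := by
  intro q
  have h1 := (contDiffAt_wulffExtension hF (gaussVector_ne_zero ν q)).contMDiffAt
  have h2 := h1.comp q (contMDiff_gaussVector hν q)
  exact h2.congr_of_eventuallyEq (Eventually.of_forall fun q' ↦ wulffMap_eq F (ν q'))

theorem contMDiff_focalMap (hF : ContMDiff (𝓡 n) 𝓘(ℝ, ℝ) ∞ F)
    (hx : ContMDiff (𝓡 n) 𝓘(ℝ, Ambient n) ∞ x) (hν : ContMDiff (𝓡 n) (𝓡 n) ∞ ν) (l : ℝ) :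
    ContMDiff (𝓡 n) 𝓘(ℝ, Ambient n) ∞ (focalMap F x ν l) :=
  hx.add (ContMDiff.smul (f := fun _ ↦ l⁻¹)
    (contMDiff_const : ContMDiff (𝓡 n) 𝓘(ℝ, ℝ) ∞ fun _ : M ↦ l⁻¹) (contMDiff_wulffMap_comp hF hν))

theorem IsOrientedHypersurface.injective
    [RiemannianBundle (fun p : M ↦ TangentSpace (𝓡 n) p)] (hx : IsOrientedHypersurface x ν) (q : M) :
    Function.Injective (differential x q) := by
  rw [injective_iff_map_eq_zero]
  intro v hv
  have := hx.isometric q v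
  rw [hv, norm_zero] at this
  exact norm_eq_zero.mp this.symm

variable [IsManifold (𝓡 n) ∞ M]

theorem differential_wulffMap_comp (hF : ContMDiff (𝓡 n) 𝓘(ℝ, ℝ) ∞ F)
    (hν : ContMDiff (𝓡 n) (𝓡 n) ∞ ν) (q : M) (v : TangentSpace (𝓡 n) q) :
    differential (fun q ↦ wulffMap F (ν q)) q v =
      fderiv ℝ (wulffExtension F) (ν q) (differential (gaussVector ν) q v) := by
  have hz := mem_extChartAt_target (I := 𝓡 n) q
  have hq : (extChartAt (𝓡 n) q).symm (extChartAt (𝓡 n) q q) = q := extChartAt_to_inv q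
  have h2 := ((contDiffAt_comp_extChartAt_symm (contMDiff_gaussVector hν) q
    hz).differentiableAt (by simp)).hasFDerivAt
  have h1 : HasFDerivAt (wulffExtension F) (fderiv ℝ (wulffExtension F) (ν q))
      ((gaussVector ν ∘ (extChartAt (𝓡 n) q).symm) (extChartAt (𝓡 n) q q)) := by
    rw [Function.comp_apply, hq]
    exact ((contDiffAt_wulffExtension hF (gaussVector_ne_zero ν q)).differentiableAt
      (by simp)).hasFDerivAt
  have h3 := (h1.comp _ h2).congr_of_eventuallyEq
    (f₁ := (fun q ↦ wulffMap F (ν q)) ∘ (extChartAt (𝓡 n) q).symm)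
    (Eventually.of_forall fun z ↦ wulffMap_eq F _)
  refine (differential_eq_fderiv (contMDiff_wulffMap_comp hF hν) q v).trans ?_
  rw [h3.fderiv]
  exact congrArg _ (differential_eq_fderiv (contMDiff_gaussVector hν) q v).symm

theorem differential_focalMap (hF : ContMDiff (𝓡 n) 𝓘(ℝ, ℝ) ∞ F)
    (hx : ContMDiff (𝓡 n) 𝓘(ℝ, Ambient n) ∞ x) (hν : ContMDiff (𝓡 n) (𝓡 n) ∞ ν) (l : ℝ)
    (q : M) (v : TangentSpace (𝓡 n) q) :
    differential (focalMap F x ν l) q v = differential x q v +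
      l⁻¹ • fderiv ℝ (wulffExtension F) (ν q) (differential (gaussVector ν) q v) := by
  rw [← differential_wulffMap_comp hF hν]
  have hz := mem_extChartAt_target (I := 𝓡 n) q
  have h1 := ((contDiffAt_comp_extChartAt_symm hx q hz).differentiableAt (by simp)).hasFDerivAt
  have h2 := ((contDiffAt_comp_extChartAt_symm (contMDiff_wulffMap_comp hF hν) q
    hz).differentiableAt (by simp)).hasFDerivAt
  have h3 : HasFDerivAt (focalMap F x ν l ∘ (extChartAt (𝓡 n) q).symm) _ _ :=
    h1.add (h2.const_smul l⁻¹)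
  refine (differential_eq_fderiv (contMDiff_focalMap hF hx hν l) q v).trans ?_
  rw [h3.fderiv]
  refine Eq.trans ?_ (congrArg₂ (fun a b : Ambient n ↦ a + l⁻¹ • b)
    (differential_eq_fderiv hx q v).symm
    (differential_eq_fderiv (contMDiff_wulffMap_comp hF hν) q v).symm)
  rfl

theorem mem_eigenspace_iff (hF : ContMDiff (𝓡 n) 𝓘(ℝ, ℝ) ∞ F)
    (hν : ContMDiff (𝓡 n) (𝓡 n) ∞ ν) {q : M} {μ : ℝ} {v : TangentSpace (𝓡 n) q} :
    v ∈ eigenspace F x ν q μ ↔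
      fderiv ℝ (wulffExtension F) (ν q) (differential (gaussVector ν) q v) =
        -μ • differential x q v := by
  rw [eigenspace, LinearMap.mem_ker, LinearMap.sub_apply, weingarten, LinearMap.neg_apply,
    LinearMap.smul_apply, differential_wulffMap_comp hF hν, sub_eq_zero, neg_eq_iff_eq_neg,
    neg_smul]

theorem ker_differential_focalMap (hF : ContMDiff (𝓡 n) 𝓘(ℝ, ℝ) ∞ F)
    (hx : ContMDiff (𝓡 n) 𝓘(ℝ, Ambient n) ∞ x) (hν : ContMDiff (𝓡 n) (𝓡 n) ∞ ν) {l : ℝ}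
    (hl : l ≠ 0) (q : M) :
    LinearMap.ker (differential (focalMap F x ν l) q) = eigenspace F x ν q l := by
  ext v
  rw [mem_eigenspace_iff hF hν, LinearMap.mem_ker, differential_focalMap hF hx hν]
  constructor
  · intro h
    have := congrArg (l • ·) h
    simp only [smul_add, smul_inv_smul₀ hl, smul_zero] at this
    rw [neg_smul]
    exact eq_neg_of_add_eq_zero_right this
  · intro h
    rw [h, smul_smul, mul_neg, inv_mul_cancel₀ hl, neg_one_smul, add_neg_cancel]

theorem inner_differential_gaussVector (hν : ContMDiff (𝓡 n) (𝓡 n) ∞ ν) (q : M)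
    (v : TangentSpace (𝓡 n) q) : ⟪gaussVector ν q, differential (gaussVector ν) q v⟫_ℝ = 0 := by
  have hz := mem_extChartAt_target (I := 𝓡 n) q
  have hq : (extChartAt (𝓡 n) q).symm (extChartAt (𝓡 n) q q) = q := extChartAt_to_inv q
  have h := inner_fderiv_of_norm_eq_one
    ((contDiffAt_comp_extChartAt_symm (contMDiff_gaussVector hν) q hz).differentiableAt (by simp))
    (Eventually.of_forall fun z' ↦ norm_gaussVector ν _) v
  rw [differential_eq_fderiv (contMDiff_gaussVector hν) q v]
  rwa [Function.comp_apply, hq] at h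

variable [RiemannianBundle (fun p : M ↦ TangentSpace (𝓡 n) p)]

theorem IsOrientedHypersurface.inner_symm (hx : IsOrientedHypersurface x ν) (q : M)
    (v w : TangentSpace (𝓡 n) q) :
    ⟪differential (gaussVector ν) q v, differential x q w⟫_ℝ =
      ⟪differential (gaussVector ν) q w, differential x q v⟫_ℝ := by
  have hz := mem_extChartAt_target (I := 𝓡 n) q
  have hN := contMDiff_gaussVector hx.smooth_gauss
  have key := inner_fderiv_normal_symm
    ((contDiffAt_comp_extChartAt_symm hx.smooth q hz).of_le (WithTop.coe_le_coe.mpr le_top))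
    ((contDiffAt_comp_extChartAt_symm hN q hz).differentiableAt (by simp)) ?_ v w
  · rw [differential_eq_fderiv hx.smooth q v, differential_eq_fderiv hx.smooth q w,
      differential_eq_fderiv hN q v, differential_eq_fderiv hN q w]
    exact key
  · filter_upwards [(isOpen_extChartAt_target q).mem_nhds hz] with z' hz' w
    obtain ⟨J, hJ⟩ := exists_fderiv_eq_differential_comp q hz'
    rw [hJ x hx.smooth]
    exact hx.normal _ _

theorem IsOrientedHypersurface.inner_focalMap (hF : ContMDiff (𝓡 n) 𝓘(ℝ, ℝ) ∞ F)
    (hx : IsOrientedHypersurface x ν) (l : ℝ) (q : M) (v : TangentSpace (𝓡 n) q) :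
    ⟪gaussVector ν q, differential (focalMap F x ν l) q v⟫_ℝ = 0 := by
  rw [differential_focalMap hF hx.smooth hx.smooth_gauss, inner_add_right, inner_smul_right]
  have h1 := hx.normal q v
  have h2 := inner_fderiv_wulffExtension_self hF (ν q)
    (inner_differential_gaussVector hx.smooth_gauss q v)
  rw [gaussVector, h1, h2, mul_zero, add_zero]

theorem IsOrientedHypersurface.inner_focalMap_symm (hF : ContMDiff (𝓡 n) 𝓘(ℝ, ℝ) ∞ F)
    (hx : IsOrientedHypersurface x ν) (l : ℝ) (q : M) (v w : TangentSpace (𝓡 n) q) :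
    ⟪differential (gaussVector ν) q v, differential (focalMap F x ν l) q w⟫_ℝ =
      ⟪differential (gaussVector ν) q w, differential (focalMap F x ν l) q v⟫_ℝ := by
  rw [differential_focalMap hF hx.smooth hx.smooth_gauss,
    differential_focalMap hF hx.smooth hx.smooth_gauss, inner_add_right, inner_add_right,
    hx.inner_symm, inner_smul_right, inner_smul_right,
    real_inner_comm _ (differential (gaussVector ν) q v),
    fderiv_wulffExtension_symm hF (ν q) (inner_differential_gaussVector hx.smooth_gauss q w)
    (inner_differential_gaussVector hx.smooth_gauss q v)]

/-- Constant multiplicity of `l` gives constant rank. If df v = 0 then symmetry of ⟨dν v, df w⟩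
makes dν v normal to the focal image; if dν v = 0 too, then dx v = 0. -/
theorem IsOrientedHypersurface.isTubular (hF : ContMDiff (𝓡 n) 𝓘(ℝ, ℝ) ∞ F)
    (hx : IsOrientedHypersurface x ν) {l : ℝ} (hl : l ≠ 0)
    (hiso : IsAnisotropicIsoparametric F x ν) (q : M) :
    IsTubular (focalMap F x ν l ∘ (extChartAt (𝓡 n) q).symm)
      (gaussVector ν ∘ (extChartAt (𝓡 n) q).symm) (extChartAt (𝓡 n) q q) := by
  have hz := mem_extChartAt_target (I := 𝓡 n) q
  have hf := contMDiff_focalMap hF hx.smooth hx.smooth_gauss l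
  have hN := contMDiff_gaussVector hx.smooth_gauss
  have hdf := differential_eq_fderiv hf q
  have hdN := differential_eq_fderiv hN q
  have htarget := (isOpen_extChartAt_target (I := 𝓡 n) q).mem_nhds hz
  have hrank : ∀ z' ∈ (extChartAt (𝓡 n) q).target,
      finrank ℝ (fderiv ℝ (focalMap F x ν l ∘ (extChartAt (𝓡 n) q).symm) z').range +
        finrank ℝ (eigenspace F x ν q l) = n := by
    intro z' hz'
    obtain ⟨J, hJ⟩ := exists_fderiv_eq_differential_comp q hz'
    have hker : finrank ℝ (fderiv ℝ (focalMap F x ν l ∘ (extChartAt (𝓡 n) q).symm) z').ker =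
        finrank ℝ (eigenspace F x ν q l) := by
      rw [hiso q ((extChartAt (𝓡 n) q).symm z') l,
        ← ker_differential_focalMap hF hx.smooth hx.smooth_gauss hl]
      refine LinearEquiv.finrank_eq (J.toLinearEquiv.ofSubmodules _ _ ?_)
      ext v
      simp only [Submodule.mem_map, LinearMap.mem_ker]
      constructor
      · rintro ⟨w, hw, rfl⟩
        exact (hJ _ hf w).symm.trans hw
      · intro hv
        obtain ⟨w, rfl⟩ := J.surjective v
        exact ⟨w, (hJ _ hf w).trans hv, rfl⟩
    rw [← hker]
    simpa using (fderiv ℝ (focalMap F x ν l ∘ (extChartAt (𝓡 n) q).symm) z' :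
      EuclideanSpace ℝ (Fin n) →ₗ[ℝ] Ambient n).finrank_range_add_finrank_ker
  refine ⟨by simp, contDiffAt_comp_extChartAt_symm hf q hz,
    contDiffAt_comp_extChartAt_symm hN q hz,
    Eventually.of_forall fun z' ↦ norm_gaussVector ν _, ?_, ?_, ?_, ?_⟩
  · filter_upwards [htarget] with z' hz' w
    obtain ⟨J, hJ⟩ := exists_fderiv_eq_differential_comp q hz'
    rw [hJ _ hf]
    exact hx.inner_focalMap hF l _ _
  · filter_upwards [htarget] with z' hz'
    exact Nat.add_right_cancel ((hrank z' hz').trans (hrank _ hz).symm)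
  · intro v hv w
    rw [← hdf] at hv
    have := hx.inner_focalMap_symm hF l q v w
    rw [hv, inner_zero_right] at this
    rw [← hdf, ← hdN]
    exact this
  · intro v hv hv'
    rw [← hdf] at hv
    rw [← hdN] at hv'
    have := differential_focalMap hF hx.smooth hx.smooth_gauss l q v
    rw [hv', hv, map_zero, smul_zero, add_zero] at this
    exact (injective_iff_map_eq_zero _).mp (hx.injective q) v this.symm

end Hypersurface

/-! ### Sheets of the focal image and their second fundamental form -/

section Focal

open Module

variable {n : ℕ} {F : UnitSphere n → ℝ} {M : Type*} {x : M → Ambient n} {ν : M → UnitSphere n}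
  [TopologicalSpace M] {l : ℝ}

/-- `H` is a smooth retraction onto the image of the focal map near `q`, which factors through the
orthogonal projection to `T`. -/
structure IsFocalRetraction (F : UnitSphere n → ℝ) (x : M → Ambient n) (ν : M → UnitSphere n)
    (l : ℝ) (T : Submodule ℝ (Ambient n)) (H : Ambient n → Ambient n) (q : M) : Prop where
  proj : ∀ y, H (T.starProjection y) = H y
  smooth : ContDiffAt ℝ ∞ H (focalMap F x ν l q)
  eventually_eq : ∀ᶠ q' in 𝓝 q, H (focalMap F x ν l q') = focalMap F x ν l q'
  fderiv_eq : fderiv ℝ H (focalMap F x ν l q) = T.starProjection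

theorem IsFocalRetraction.of_eventually {T : Submodule ℝ (Ambient n)}
    {H : Ambient n → Ambient n} {p q : M} (h : IsFocalRetraction F x ν l T H p)
    (hpq : focalMap F x ν l q = focalMap F x ν l p)
    (hq : ∀ᶠ q' in 𝓝 q, H (focalMap F x ν l q') = focalMap F x ν l q') :
    IsFocalRetraction F x ν l T H q :=
  ⟨h.proj, hpq ▸ h.smooth, hq, hpq ▸ h.fderiv_eq⟩

variable [ChartedSpace (EuclideanSpace ℝ (Fin n)) M]

theorem range_differential_eq {g : M → Ambient n} (hg : ContMDiff (𝓡 n) 𝓘(ℝ, Ambient n) ∞ g)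
    (q : M) : LinearMap.range (differential g q) =
      (fderiv ℝ (g ∘ (extChartAt (𝓡 n) q).symm) (extChartAt (𝓡 n) q q)).range := by
  ext y
  constructor
  · rintro ⟨v, rfl⟩
    exact ⟨v, (differential_eq_fderiv hg q v).symm⟩
  · rintro ⟨v, rfl⟩
    exact ⟨v, differential_eq_fderiv hg q v⟩

theorem eventually_comp_extChartAt_symm {q : M} {P : M → Prop} (h : ∀ᶠ q' in 𝓝 q, P q') :
    ∀ᶠ z in 𝓝 (extChartAt (𝓡 n) q q), P ((extChartAt (𝓡 n) q).symm z) := by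
  have := continuousAt_extChartAt_symm (I := 𝓡 n) q
  rw [ContinuousAt, extChartAt_to_inv] at this
  exact this.eventually h

variable [IsManifold (𝓡 n) ∞ M] [RiemannianBundle (fun p : M ↦ TangentSpace (𝓡 n) p)]

theorem IsOrientedHypersurface.finrank_range (hF : ContMDiff (𝓡 n) 𝓘(ℝ, ℝ) ∞ F)
    (hx : IsOrientedHypersurface x ν) (hl : l ≠ 0)
    (hiso : IsAnisotropicIsoparametric F x ν) (p q : M) :
    finrank ℝ (LinearMap.range (differential (focalMap F x ν l) p)) =
      finrank ℝ (LinearMap.range (differential (focalMap F x ν l) q)) := by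
  have key : ∀ p : M, finrank ℝ (LinearMap.range (differential (focalMap F x ν l) p)) +
      finrank ℝ (eigenspace F x ν p l) = n := by
    intro p
    have : FiniteDimensional ℝ (TangentSpace (𝓡 n) p) :=
      inferInstanceAs (FiniteDimensional ℝ (EuclideanSpace ℝ (Fin n)))
    rw [← ker_differential_focalMap hF hx.smooth hx.smooth_gauss hl,
      LinearMap.finrank_range_add_finrank_ker]
    exact finrank_euclideanSpace_fin
  have h1 := key p
  rw [hiso p q l] at h1
  exact Nat.add_right_cancel (h1.trans (key q).symm)

/-- Near each point the image of the focal map is parametrized by its tangent space, and the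
fibre of the focal map through the point is parametrized by the Gauss map. -/
theorem IsOrientedHypersurface.exists_section (hF : ContMDiff (𝓡 n) 𝓘(ℝ, ℝ) ∞ F)
    (hx : IsOrientedHypersurface x ν) (hl : l ≠ 0)
    (hiso : IsAnisotropicIsoparametric F x ν) (q : M) {T : Submodule ℝ (Ambient n)}
    (hT : LinearMap.range (differential (focalMap F x ν l) q) = T) :
    (∃ σ : Ambient n → M, (∀ y, σ (T.starProjection y) = σ y) ∧
      Tendsto σ (𝓝 (focalMap F x ν l q)) (𝓝 q) ∧
      ContDiffAt ℝ ∞ (focalMap F x ν l ∘ σ) (focalMap F x ν l q) ∧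
      (∀ᶠ y in 𝓝 (focalMap F x ν l q),
        T.starProjection (focalMap F x ν l (σ y)) = T.starProjection y) ∧
      ∀ᶠ q' in 𝓝 q, focalMap F x ν l (σ (focalMap F x ν l q')) = focalMap F x ν l q') ∧
    ∃ Γ : Ambient n → M, ContMDiffAt 𝓘(ℝ, Ambient n) (𝓡 n) ∞ Γ (gaussVector ν q) ∧
      Γ (gaussVector ν q) = q ∧
      ∀ᶠ m in 𝓝 (gaussVector ν q), ‖m‖ = 1 → m ∈ Tᗮ →
        focalMap F x ν l (Γ m) = focalMap F x ν l q ∧ gaussVector ν (Γ m) = m := by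
  have hf := contMDiff_focalMap hF hx.smooth hx.smooth_gauss l
  rw [range_differential_eq hf] at hT
  obtain ⟨Ψ, hΨ, hΨz, hpf, hret, hcurve⟩ := (hx.isTubular hF hl hiso q).exists_section hT
  have hz := mem_extChartAt_target (I := 𝓡 n) q
  have hq : (extChartAt (𝓡 n) q).symm (extChartAt (𝓡 n) q q) = q := extChartAt_to_inv q
  simp only [Function.comp_apply, hq] at hΨ hΨz hpf hret hcurve
  have hproj : ∀ y, T.starProjection (T.starProjection y) = T.starProjection y := fun y ↦
    Submodule.starProjection_eq_self_iff.mpr (T.starProjection_apply_mem y)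
  have hsymm : ContMDiffAt 𝓘(ℝ, EuclideanSpace ℝ (Fin n)) (𝓡 n) ∞ (extChartAt (𝓡 n) q).symm
      (extChartAt (𝓡 n) q q) :=
    (contMDiffOn_extChartAt_symm (I := 𝓡 n) (n := ∞) q).contMDiffAt
      ((isOpen_extChartAt_target q).mem_nhds hz)
  have hΨM : ContMDiffAt 𝓘(ℝ, Ambient n) (𝓡 n) ∞ (fun y ↦ (extChartAt (𝓡 n) q).symm (Ψ y))
      (T.starProjection (focalMap F x ν l q)) := by
    refine ContMDiffAt.comp _ ?_ hΨ.contMDiffAt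
    rw [hΨz]
    exact hsymm
  refine ⟨⟨fun y ↦ (extChartAt (𝓡 n) q).symm (Ψ (T.starProjection y)), fun y ↦ by
    simp only [hproj], ?_, ?_, hpf, ?_⟩, fun m ↦ (extChartAt (𝓡 n) q).symm
      (Ψ (T.starProjection (focalMap F x ν l q) + (m - gaussVector ν q))), ?_, ?_, hcurve⟩
  · have := (hΨM.continuousAt.comp_of_eq
      (T.starProjection.continuous.continuousAt (x := focalMap F x ν l q)) rfl).tendsto
    rw [Function.comp_def] at this
    simpa only [hΨz, hq] using this
  · refine ContMDiffAt.contDiffAt ?_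
    refine (hf _).comp _ (hΨM.comp (focalMap F x ν l q)
      (T.starProjection.contDiff.contDiffAt.contMDiffAt))
  · have hcont := (continuousAt_extChartAt (I := 𝓡 n) q).eventually hret
    filter_upwards [hcont, extChartAt_source_mem_nhds (I := 𝓡 n) q] with q' h1 h2
    rwa [(extChartAt (𝓡 n) q).left_inv h2] at h1
  · have h1 : ContDiffAt ℝ ∞
        (fun m ↦ T.starProjection (focalMap F x ν l q) + (m - gaussVector ν q))
        (gaussVector ν q) := contDiffAt_const.add (contDiffAt_id.sub contDiffAt_const)
    refine ContMDiffAt.comp_of_eq (g := fun y ↦ (extChartAt (𝓡 n) q).symm (Ψ y))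
      (x := gaussVector ν q) hΨM h1.contMDiffAt ?_
    simp
  · simp only [sub_self, add_zero, hΨz, hq]

theorem IsOrientedHypersurface.exists_isFocalRetraction (hF : ContMDiff (𝓡 n) 𝓘(ℝ, ℝ) ∞ F)
    (hx : IsOrientedHypersurface x ν) (hl : l ≠ 0)
    (hiso : IsAnisotropicIsoparametric F x ν) (q : M) {T : Submodule ℝ (Ambient n)}
    (hT : LinearMap.range (differential (focalMap F x ν l) q) = T) :
    ∃ H, IsFocalRetraction F x ν l T H q := by
  have hf := contMDiff_focalMap hF hx.smooth hx.smooth_gauss l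
  obtain ⟨⟨σ, h1, -, h3, -, h5⟩, -⟩ := hx.exists_section hF hl hiso q hT
  have hq : (extChartAt (𝓡 n) q).symm (extChartAt (𝓡 n) q q) = q := extChartAt_to_inv q
  have hz := mem_extChartAt_target (I := 𝓡 n) q
  refine ⟨focalMap F x ν l ∘ σ, fun y ↦ by simp only [Function.comp_apply, h1], h3, h5, ?_⟩
  rw [range_differential_eq hf] at hT
  have := fderiv_retraction (H := focalMap F x ν l ∘ σ)
    ((contDiffAt_comp_extChartAt_symm hf q hz).differentiableAt (by simp))
    (by rw [Function.comp_apply, hq]; exact h3.differentiableAt (by simp))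
    (fun y ↦ by simp only [Function.comp_apply, h1]) (eventually_comp_extChartAt_symm h5) hT
  rwa [Function.comp_apply, hq] at this

theorem IsFocalRetraction.range_eq (hF : ContMDiff (𝓡 n) 𝓘(ℝ, ℝ) ∞ F)
    (hx : IsOrientedHypersurface x ν) {T : Submodule ℝ (Ambient n)} {H : Ambient n → Ambient n}
    {q : M} (h : IsFocalRetraction F x ν l T H q)
    (hrank : finrank ℝ (LinearMap.range (differential (focalMap F x ν l) q)) = finrank ℝ T) :
    LinearMap.range (differential (focalMap F x ν l) q) = T := by
  have hf := contMDiff_focalMap hF hx.smooth hx.smooth_gauss l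
  have hq : (extChartAt (𝓡 n) q).symm (extChartAt (𝓡 n) q q) = q := extChartAt_to_inv q
  have hz := mem_extChartAt_target (I := 𝓡 n) q
  rw [range_differential_eq hf] at hrank ⊢
  exact range_fderiv_eq_of_retraction
    ((contDiffAt_comp_extChartAt_symm hf q hz).differentiableAt (by simp))
    (by rw [Function.comp_apply, hq]; exact h.fderiv_eq)
    (by rw [Function.comp_apply, hq]; exact h.smooth.differentiableAt (by simp))
    (eventually_comp_extChartAt_symm h.eventually_eq) hrank

theorem IsFocalRetraction.inner_eq (hF : ContMDiff (𝓡 n) 𝓘(ℝ, ℝ) ∞ F)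
    (hx : IsOrientedHypersurface x ν) {T : Submodule ℝ (Ambient n)} {H : Ambient n → Ambient n}
    {q : M} (h : IsFocalRetraction F x ν l T H q)
    (hT : LinearMap.range (differential (focalMap F x ν l) q) = T) (v w : TangentSpace (𝓡 n) q) :
    ⟪differential (gaussVector ν) q v, differential (focalMap F x ν l) q w⟫_ℝ =
      -⟪gaussVector ν q, fderiv ℝ (fderiv ℝ H) (focalMap F x ν l q)
        (differential (focalMap F x ν l) q v) (differential (focalMap F x ν l) q w)⟫_ℝ := by
  have hf := contMDiff_focalMap hF hx.smooth hx.smooth_gauss l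
  have hN := contMDiff_gaussVector hx.smooth_gauss
  have hq : (extChartAt (𝓡 n) q).symm (extChartAt (𝓡 n) q q) = q := extChartAt_to_inv q
  have hz := mem_extChartAt_target (I := 𝓡 n) q
  have h2 : (2 : ℕ∞ω) ≤ ∞ := WithTop.coe_le_coe.mpr le_top
  rw [range_differential_eq hf] at hT
  have key := inner_fderiv_normal_eq (H := H) (T := T)
    ((contDiffAt_comp_extChartAt_symm hf q hz).of_le h2)
    ((contDiffAt_comp_extChartAt_symm hN q hz).differentiableAt (by simp))
    (by rw [Function.comp_apply, hq]; exact h.smooth.of_le h2) ?_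
    (by rw [Function.comp_apply, hq]; exact h.fderiv_eq)
    (eventually_comp_extChartAt_symm h.eventually_eq) hT v w
  · rw [Function.comp_apply, Function.comp_apply, hq] at key
    rw [differential_eq_fderiv hf q v, differential_eq_fderiv hf q w,
      differential_eq_fderiv hN q v]
    exact key
  · filter_upwards [(isOpen_extChartAt_target q).mem_nhds hz] with z' hz' w
    obtain ⟨J, hJ⟩ := exists_fderiv_eq_differential_comp q hz'
    rw [hJ _ hf]
    exact hx.inner_focalMap hF l _ _

/-- Two retractions that agree with the focal map near a common point have the same germ. -/
theorem IsFocalRetraction.eventuallyEq (hF : ContMDiff (𝓡 n) 𝓘(ℝ, ℝ) ∞ F)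
    (hx : IsOrientedHypersurface x ν) (hl : l ≠ 0)
    (hiso : IsAnisotropicIsoparametric F x ν) {T : Submodule ℝ (Ambient n)}
    {H H' : Ambient n → Ambient n} {q : M} (h : IsFocalRetraction F x ν l T H q)
    (h' : IsFocalRetraction F x ν l T H' q)
    (hT : LinearMap.range (differential (focalMap F x ν l) q) = T) :
    H =ᶠ[𝓝 (focalMap F x ν l q)] H' := by
  obtain ⟨⟨σ, -, h2, -, h4, -⟩, -⟩ := hx.exists_section hF hl hiso q hT
  filter_upwards [h4, h2.eventually h.eventually_eq, h2.eventually h'.eventually_eq]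
    with y hy e e'
  -- Near the focal point both retractions send `y` to the focal value at σ y, the point over the
  -- projection of `y`.
  rw [← h.proj y, ← hy, h.proj, e, ← h'.proj y, ← hy, h'.proj, e']

end Focal

/-! ### Great circles of normals -/

section GreatCircle

open Real

variable {V : Type*} [NormedAddCommGroup V] [InnerProductSpace ℝ V]

theorem norm_cos_smul_add_sin_smul {u w : V} (hu : ‖u‖ = 1) (hw : ‖w‖ = 1)
    (huw : ⟪u, w⟫_ℝ = 0) (t : ℝ) : ‖cos t • u + sin t • w‖ = 1 := by
  have h : ‖cos t • u + sin t • w‖ ^ 2 = 1 := by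
    rw [norm_add_sq_real, norm_smul, norm_smul, inner_smul_left, inner_smul_right, huw, hu, hw]
    simp
  exact (pow_eq_one_iff_of_nonneg (norm_nonneg _) two_ne_zero).mp h

theorem contDiff_cos_smul_add_sin_smul (u w : V) :
    ContDiff ℝ ∞ fun t : ℝ ↦ cos t • u + sin t • w :=
  (contDiff_cos.smul contDiff_const).add (contDiff_sin.smul contDiff_const)

end GreatCircle

/-! ### The point of the focal fibre with opposite normal -/

section Opposite

open Module
open scoped ENNReal NNReal

variable {n : ℕ} {F : UnitSphere n → ℝ} {M : Type*} [EMetricSpace M]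
  [ChartedSpace (EuclideanSpace ℝ (Fin n)) M]
  [RiemannianBundle (fun p : M ↦ TangentSpace (𝓡 n) p)]
  {x : M → Ambient n} {ν : M → UnitSphere n}

/-- Since `dx` is isometric, the length of γ is that of x∘γ, and it bounds the Riemannian distance.
-/
theorem IsOrientedHypersurface.edist_le [IsRiemannianManifold (𝓡 n) M]
    (hx : IsOrientedHypersurface x ν) {γ : ℝ → M} {a b : ℝ} (hab : a ≤ b)
    (hγ : ∀ s ∈ Set.Icc a b, ContMDiffAt 𝓘(ℝ, ℝ) (𝓡 n) 1 γ s) {C : ℝ≥0}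
    (hC : ∀ s ∈ Set.Ioo a b, ‖deriv (x ∘ γ) s‖ ≤ C) :
    edist (γ a) (γ b) ≤ C * edist a b := by
  rw [IsRiemannianManifold.out (I := 𝓡 n) (γ a) (γ b)]
  refine (Manifold.riemannianEDist_le_pathELength
    (fun s hs ↦ (hγ s hs).contMDiffWithinAt) rfl rfl hab).trans ?_
  rw [Manifold.pathELength_eq_lintegral_mfderiv_Ioo]
  have hspeed : ∀ s ∈ Set.Ioo a b,
      ‖(mfderiv 𝓘(ℝ, ℝ) (𝓡 n) γ s (1 : ℝ) : TangentSpace (𝓡 n) (γ s))‖ₑ ≤ C := by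
    intro s hs
    have h1 : MDifferentiableAt 𝓘(ℝ, ℝ) (𝓡 n) γ s :=
      (hγ s (Set.Ioo_subset_Icc_self hs)).mdifferentiableAt (by simp)
    have h2 : MDifferentiableAt (𝓡 n) 𝓘(ℝ, Ambient n) x (γ s) :=
      hx.smooth.mdifferentiableAt (by simp)
    have h3 := mfderiv_comp s h2 h1
    rw [mfderiv_eq_fderiv] at h3
    have h4 : deriv (x ∘ γ) s =
        differential x (γ s) (mfderiv 𝓘(ℝ, ℝ) (𝓡 n) γ s (1 : ℝ)) := by
      rw [← fderiv_apply_one_eq_deriv, h3]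
      rfl
    have h5 := hC s hs
    rw [h4, hx.isometric] at h5
    rw [← ofReal_norm, ← ENNReal.ofReal_coe_nnreal]
    exact ENNReal.ofReal_le_ofReal h5
  refine (MeasureTheory.setLIntegral_mono measurable_const hspeed).trans ?_
  rw [MeasureTheory.setLIntegral_const, Real.volume_Ioo, edist_comm, edist_dist, Real.dist_eq,
    abs_of_nonneg (sub_nonneg.mpr hab)]

variable {l : ℝ} [IsManifold (𝓡 n) ∞ M]

/-- The retraction condition needs care under limits. A retraction H' at the limit point is also one
at nearby points of the fibre, where it shares its tangent space, hence its germ at the focal point,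
with H; so H works at the limit. -/
theorem IsOrientedHypersurface.isClosed_focalFibre (hF : ContMDiff (𝓡 n) 𝓘(ℝ, ℝ) ∞ F)
    (hx : IsOrientedHypersurface x ν) (hl : l ≠ 0)
    (hiso : IsAnisotropicIsoparametric F x ν) {p : M} {T : Submodule ℝ (Ambient n)}
    (hT : LinearMap.range (differential (focalMap F x ν l) p) = T) (H : Ambient n → Ambient n)
    (c : Ambient n) {m : ℝ → Ambient n} (hm : Continuous m) :
    IsClosed {z : ℝ × M | (gaussVector ν z.2 = m z.1 ∧ focalMap F x ν l z.2 = c) ∧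
      IsFocalRetraction F x ν l T H z.2} := by
  have hf := contMDiff_focalMap hF hx.smooth hx.smooth_gauss l
  have hN := contMDiff_gaussVector hx.smooth_gauss
  have hclosed : IsClosed {z : ℝ × M | gaussVector ν z.2 = m z.1 ∧ focalMap F x ν l z.2 = c} :=
    (isClosed_eq (hN.continuous.comp continuous_snd) (hm.comp continuous_fst)).inter
      (isClosed_eq (hf.continuous.comp continuous_snd) continuous_const)
  rw [isClosed_iff_frequently]
  rintro ⟨t, q⟩ hfreq
  have hq := (isClosed_iff_frequently.mp hclosed) (t, q) (hfreq.mono fun z hz ↦ hz.1)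
  refine ⟨hq, ?_⟩
  obtain ⟨H', hH'⟩ := hx.exists_isFocalRetraction hF hl hiso q rfl
  have hev : ∀ᶠ z : ℝ × M in 𝓝 (t, q), ∀ᶠ q'' in 𝓝 z.2,
      H' (focalMap F x ν l q'') = focalMap F x ν l q'' :=
    (continuousAt_snd (p := (t, q))).eventually hH'.eventually_eq.eventually_nhds
  obtain ⟨⟨t', q'⟩, ⟨⟨-, hq'⟩, hret⟩, hq''⟩ := (hfreq.and_eventually hev).exists
  simp only at hq' hret hq'' hq
  have hret' := hH'.of_eventually (hq'.trans hq.2.symm) hq''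
  have hr : LinearMap.range (differential (focalMap F x ν l) q') = T :=
    hret.range_eq hF hx (by rw [← hT]; exact hx.finrank_range hF hl hiso _ _)
  have hr' := hret'.range_eq hF hx (hx.finrank_range hF hl hiso _ _)
  rw [← hr', hr] at hret'
  have hgerm := hret.eventuallyEq hF hx hl hiso hret' hr
  rw [hq', ← hq.2] at hgerm
  refine hret.of_eventually (hq.2.trans hq'.symm) ?_
  filter_upwards [hH'.eventually_eq, hf.continuous.continuousAt.eventually hgerm] with q1 h1 h2
  rw [h2, h1]

/-- The fibre of the focal map through `p` contains a point with the opposite normal, by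
continuation along a great circle of normals. -/
theorem IsOrientedHypersurface.exists_opposite [IsRiemannianManifold (𝓡 n) M] [CompleteSpace M]
    (hF : ContMDiff (𝓡 n) 𝓘(ℝ, ℝ) ∞ F)
    (hx : IsOrientedHypersurface x ν) (hl : l ≠ 0)
    (hiso : IsAnisotropicIsoparametric F x ν) {p : M} {T : Submodule ℝ (Ambient n)}
    (hT : LinearMap.range (differential (focalMap F x ν l) p) = T) {H : Ambient n → Ambient n}
    (hH : IsFocalRetraction F x ν l T H p) {w : Ambient n} (hw : ‖w‖ = 1)
    (hpw : ⟪gaussVector ν p, w⟫_ℝ = 0) (hwT : w ∈ Tᗮ) :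
    ∃ q, gaussVector ν q = -gaussVector ν p ∧ focalMap F x ν l q = focalMap F x ν l p ∧
      IsFocalRetraction F x ν l T H q := by
  have hf := contMDiff_focalMap hF hx.smooth hx.smooth_gauss l
  have hN := contMDiff_gaussVector hx.smooth_gauss
  set u := gaussVector ν p with hu
  have huT : u ∈ Tᗮ := by
    rw [Submodule.mem_orthogonal']
    intro y hy
    obtain ⟨v, rfl⟩ := hT.ge hy
    exact hx.inner_focalMap hF l p v
  let m : ℝ → Ambient n := fun t ↦ Real.cos t • u + Real.sin t • w
  have hm : ContDiff ℝ ∞ m := contDiff_cos_smul_add_sin_smul u w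
  have hm1 : ∀ t, ‖m t‖ = 1 := norm_cos_smul_add_sin_smul (norm_gaussVector ν p) hw hpw
  have hmT : ∀ t, m t ∈ Tᗮ := fun t ↦
    Tᗮ.add_mem (Tᗮ.smul_mem _ huT) (Tᗮ.smul_mem _ hwT)
  -- The position that x must take on this fibre where the normal is m t. Its speed bound on [0, π]
  -- serves as the Lipschitz constant for every local continuation.
  let X : ℝ → Ambient n := fun t ↦ focalMap F x ν l p - l⁻¹ • wulffExtension F (m t)
  have hX : ContDiff ℝ ∞ X := by
    rw [contDiff_iff_contDiffAt]
    intro t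
    have h0 : m t ≠ 0 := norm_ne_zero_iff.mp (by rw [hm1]; exact one_ne_zero)
    exact contDiffAt_const.sub
      (((contDiffAt_wulffExtension hF h0).comp t hm.contDiffAt).const_smul l⁻¹)
  obtain ⟨C, hC⟩ := (isCompact_Icc (a := (0 : ℝ)) (b := Real.pi)).exists_bound_of_continuousOn
    (hX.continuous_deriv (by simp)).continuousOn
  suffices hext : _ by
    obtain ⟨q, ⟨hqN, hqf⟩, hqH⟩ := exists_mem_of_lipschitz_continuation
      (hx.isClosed_focalFibre hF hl hiso hT H (focalMap F x ν l p) hm.continuous) C.toNNReal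
      Real.pi_pos.le (p := p) ⟨⟨by simp [m, hu], rfl⟩, hH⟩ hext
    exact ⟨q, by simpa [m] using hqN, hqf, hqH⟩
  rintro t q ⟨⟨hqN, hqf⟩, hqH⟩ ht0 htπ
  simp only at hqN hqf hqH
  have hr : LinearMap.range (differential (focalMap F x ν l) q) = T :=
    hqH.range_eq hF hx (by rw [← hT]; exact hx.finrank_range hF hl hiso _ _)
  obtain ⟨-, Γ, hΓ, hΓq, hΓm⟩ := hx.exists_section hF hl hiso q hr
  rw [hqN] at hΓ hΓq hΓm
  have hγ : ContMDiffAt 𝓘(ℝ, ℝ) (𝓡 n) 1 (fun s ↦ Γ (m s)) t :=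
    (hΓ.comp t hm.contDiffAt.contMDiffAt).of_le (by simp)
  have hγ1 : ∀ᶠ s in 𝓝 t, ContMDiffAt 𝓘(ℝ, ℝ) (𝓡 n) 1 (fun s ↦ Γ (m s)) s := by
    have : IsManifold (𝓡 n) 1 M := IsManifold.of_le (n := ∞) (by simp)
    exact (contMDiffAt_iff_contMDiffAt_nhds (by simp)).mp hγ
  have hγt : Tendsto (fun s ↦ Γ (m s)) (𝓝 t) (𝓝 q) := by
    have := hγ.continuousAt.tendsto
    rwa [hΓq] at this
  have hev : ∀ᶠ s in 𝓝 t, ContMDiffAt 𝓘(ℝ, ℝ) (𝓡 n) 1 (fun s ↦ Γ (m s)) s ∧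
      (focalMap F x ν l (Γ (m s)) = focalMap F x ν l p ∧ gaussVector ν (Γ (m s)) = m s) ∧
      ∀ᶠ q' in 𝓝 (Γ (m s)), H (focalMap F x ν l q') = focalMap F x ν l q' := by
    refine hγ1.and (Eventually.and ?_ (hγt.eventually hqH.eventually_eq.eventually_nhds))
    filter_upwards [hm.continuous.continuousAt.eventually hΓm] with s hs
    rw [← hqf]
    exact hs (hm1 s) (hmT s)
  obtain ⟨ε, hε, hball⟩ := Metric.eventually_nhds_iff_ball.mp hev
  let t' := min (t + ε / 2) Real.pi
  have htt' : t < t' := lt_min (by linarith) htπ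
  have hmem : ∀ s ∈ Set.Icc t t', s ∈ Metric.ball t ε := by
    intro s hs
    rw [Metric.mem_ball, Real.dist_eq, abs_of_nonneg (by linarith [hs.1])]
    linarith [hs.2, min_le_left (t + ε / 2) Real.pi]
  obtain ⟨-, ⟨h1, h2⟩, h3⟩ := hball t' (hmem t' ⟨htt'.le, le_rfl⟩)
  refine ⟨t', ⟨htt', min_le_right _ _⟩, Γ (m t'),
    ⟨⟨h2, h1⟩, hqH.of_eventually (h1.trans hqf.symm) h3⟩, ?_⟩
  have key := hx.edist_le (γ := fun s ↦ Γ (m s)) htt'.le (fun s hs ↦ (hball s (hmem s hs)).1)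
    (C := C.toNNReal) ?_
  · simp only [hΓq] at key
    exact key
  · intro s hs
    have hxX : (x ∘ fun s ↦ Γ (m s)) =ᶠ[𝓝 s] X := by
      filter_upwards [Ioo_mem_nhds hs.1 hs.2] with s' hs'
      obtain ⟨-, ⟨e1, e2⟩, -⟩ := hball s' (hmem s' (Set.Ioo_subset_Icc_self hs'))
      change x (Γ (m s')) = focalMap F x ν l p - l⁻¹ • wulffExtension F (m s')
      rw [← e1, focalMap, wulffMap_eq]
      change _ = _ + l⁻¹ • wulffExtension F (gaussVector ν (Γ (m s'))) - _
      rw [e2, add_sub_cancel_right]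
    rw [hxX.deriv_eq]
    exact (hC s ⟨ht0.trans hs.1.le, hs.2.le.trans (min_le_right _ _)⟩).trans (Real.le_coe_toNNReal C)

end Opposite

/-! ### Comparison at opposite normals and the choice of `l` -/

section PrincipalCurvatures

open Module

variable {n : ℕ} {F : UnitSphere n → ℝ} {M : Type*} {x : M → Ambient n} {ν : M → UnitSphere n}

section

variable [TopologicalSpace M] [ChartedSpace (EuclideanSpace ℝ (Fin n)) M]

theorem finiteDimensional_tangentSpace (p : M) : FiniteDimensional ℝ (TangentSpace (𝓡 n) p) :=
  inferInstanceAs (FiniteDimensional ℝ (EuclideanSpace ℝ (Fin n)))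

theorem mem_principalCurvatures_iff {p : M} {μ : ℝ} :
    μ ∈ principalCurvatures F x ν p ↔ ∃ v ∈ eigenspace F x ν p μ, v ≠ 0 :=
  Submodule.ne_bot_iff _

theorem IsAnisotropicIsoparametric.principalCurvatures_eq
    (hiso : IsAnisotropicIsoparametric F x ν) (p q : M) :
    principalCurvatures F x ν p = principalCurvatures F x ν q := by
  have := finiteDimensional_tangentSpace (n := n) p
  have := finiteDimensional_tangentSpace (n := n) q
  ext μ
  change ¬ _ ↔ ¬ _
  rw [← Submodule.finrank_eq_zero, ← Submodule.finrank_eq_zero (S := eigenspace F x ν q μ),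
    hiso p q μ]

theorem finite_principalCurvatures [RiemannianBundle (fun p : M ↦ TangentSpace (𝓡 n) p)]
    (hx : IsOrientedHypersurface x ν) (p : M) : (principalCurvatures F x ν p).Finite := by
  have := finiteDimensional_tangentSpace (n := n) p
  obtain ⟨g, hg⟩ := LinearMap.exists_leftInverse_of_injective (differential x p)
    (LinearMap.ker_eq_bot.mpr (hx.injective p))
  refine (Module.End.finite_hasEigenvalue (g ∘ₗ weingarten F ν p)).subset fun μ hμ ↦ ?_
  obtain ⟨v, hv, hv0⟩ := mem_principalCurvatures_iff.mp hμ
  refine Module.End.hasEigenvalue_of_hasEigenvector (x := v) ⟨?_, hv0⟩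
  rw [Module.End.mem_eigenspace_iff, LinearMap.comp_apply]
  rw [eigenspace, LinearMap.mem_ker, LinearMap.sub_apply, sub_eq_zero] at hv
  rw [hv, LinearMap.smul_apply, map_smul]
  exact congrArg (μ • ·) (LinearMap.congr_fun hg v)

variable [IsManifold (𝓡 n) ∞ M]

theorem IsOrientedHypersurface.focalForm_nonneg
    [RiemannianBundle (fun p : M ↦ TangentSpace (𝓡 n) p)] (hF : IsAnisotropicDensity F)
    (hx : IsOrientedHypersurface x ν) {l ε : ℝ} {p : M}
    (h : ∀ μ ∈ principalCurvatures F x ν p, 0 ≤ ε * (-μ * (1 - l⁻¹ * μ)))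
    (v : TangentSpace (𝓡 n) p) :
    0 ≤ ε * ⟪differential (gaussVector ν) p v, differential (focalMap F x ν l) p v⟫_ℝ := by
  have := finiteDimensional_tangentSpace (n := n) p
  have hν := hx.smooth_gauss
  rw [differential_focalMap hF.smooth hx.smooth hν]
  refine AnisotropicHypersurface.focalForm_nonneg (u := gaussVector ν p)
    (A := (fderiv ℝ (wulffExtension F) (ν p)).toLinearMap) ?_ (norm_gaussVector ν p)
    (hx.injective p) (hx.normal p) (inner_differential_gaussVector hν p) (hx.inner_symm p)
    (fun v hv ↦ inner_fderiv_wulffExtension_self hF.smooth (ν p) hv)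
    (fun v w hv hw ↦ fderiv_wulffExtension_symm hF.smooth (ν p) hv hw)
    (fun v hv hv0 ↦ fderiv_wulffExtension_pos hF (ν p) hv hv0) ?_ v
  · have : finrank ℝ (TangentSpace (𝓡 n) p) = n := finrank_euclideanSpace_fin (𝕜 := ℝ) (n := n)
    rw [this, finrank_euclideanSpace_fin]
  · intro m v hv hm
    have hmem : -m ∈ principalCurvatures F x ν p := by
      refine mem_principalCurvatures_iff.mpr ⟨v, ?_, hv⟩
      rw [mem_eigenspace_iff hF.smooth hν, neg_neg]
      exact hm
    have := h _ hmem
    rwa [neg_neg, mul_neg, sub_neg_eq_add] at this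

theorem differential_gaussVector_ne_zero
    [RiemannianBundle (fun p : M ↦ TangentSpace (𝓡 n) p)]
    (hF : ContMDiff (𝓡 n) 𝓘(ℝ, ℝ) ∞ F) (hx : IsOrientedHypersurface x ν) {μ : ℝ} (hμ : μ ≠ 0)
    {p : M} {v : TangentSpace (𝓡 n) p} (hv : v ∈ eigenspace F x ν p μ) (hv0 : v ≠ 0) :
    differential (gaussVector ν) p v ≠ 0 := by
  intro h0
  rw [mem_eigenspace_iff hF hx.smooth_gauss, h0, map_zero] at hv
  rcases smul_eq_zero.mp hv.symm with h | h
  · exact hμ (neg_eq_zero.mp h)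
  · exact hv0 ((injective_iff_map_eq_zero _).mp (hx.injective p) v h)

end

variable [EMetricSpace M] [ChartedSpace (EuclideanSpace ℝ (Fin n)) M] [IsManifold (𝓡 n) ∞ M]
  [RiemannianBundle (fun p : M ↦ TangentSpace (𝓡 n) p)] [IsRiemannianManifold (𝓡 n) M]
  [CompleteSpace M]

/-- If the numbers `-μ (1 - μ / l)` have the same weak sign for all principal curvatures `μ`, then
`0` and `l` are the only principal curvatures. -/
theorem eq_zero_or_eq_of_forall_nonneg (hF : IsAnisotropicDensity F)
    (hx : IsOrientedHypersurface x ν) (hiso : IsAnisotropicIsoparametric F x ν) {p : M}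
    {l ε : ℝ} (hl : l ≠ 0) (hε : ε ≠ 0) (hlp : l ∈ principalCurvatures F x ν p)
    (h : ∀ μ ∈ principalCurvatures F x ν p, 0 ≤ ε * (-μ * (1 - l⁻¹ * μ))) {μ : ℝ}
    (hμ : μ ∈ principalCurvatures F x ν p) : μ = 0 ∨ μ = l := by
  by_contra! hne
  have hν := hx.smooth_gauss
  obtain ⟨X₀, hX₀, hX₀0⟩ := mem_principalCurvatures_iff.mp hlp
  obtain ⟨X, hX, hX0⟩ := mem_principalCurvatures_iff.mp hμ
  have hdX₀ := differential_gaussVector_ne_zero hF.smooth hx hl hX₀ hX₀0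
  have hdX := differential_gaussVector_ne_zero hF.smooth hx hne.1 hX hX0
  set a := differential (gaussVector ν) p X₀ with ha
  have hf0 : differential (focalMap F x ν l) p X₀ = 0 := by
    rw [← LinearMap.mem_ker, ker_differential_focalMap hF.smooth hx.smooth hν hl]
    exact hX₀
  obtain ⟨H, hH⟩ := hx.exists_isFocalRetraction hF.smooth hl hiso p rfl
  -- The great circle starts in the direction dν X₀ for an `l`-eigenvector X₀. By symmetry ⟨dν X₀,
  -- df v⟩ = ⟨dν v, df X₀⟩ = 0, so this direction is normal to the focal image.
  obtain ⟨q, hqN, hqf, hqH⟩ := hx.exists_opposite hF.smooth hl hiso rfl hH (w := ‖a‖⁻¹ • a)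
    (by rw [norm_smul, norm_inv, norm_norm, inv_mul_cancel₀ (norm_ne_zero_iff.mpr hdX₀)])
    (by rw [inner_smul_right, ha, inner_differential_gaussVector hν, mul_zero])
    (Submodule.smul_mem _ _ (by
      rw [Submodule.mem_orthogonal']
      rintro _ ⟨v, rfl⟩
      rw [ha, hx.inner_focalMap_symm hF.smooth, hf0, inner_zero_right]))
  have hr := hqH.range_eq hF.smooth hx (hx.finrank_range hF.smooth hl hiso _ _)
  -- Y at q has the same focal image vector as X at p. The forms at (p, X) and (q, Y) are therefore
  -- negatives of each other, while `h` gives both the same weak sign.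
  obtain ⟨Y, hY⟩ := hr.ge ⟨X, rfl⟩
  have hp := hH.inner_eq hF.smooth hx rfl X X
  have hq := hqH.inner_eq hF.smooth hx hr Y Y
  rw [hY, hqN, hqf, inner_neg_left, neg_neg] at hq
  have hp0 := hx.focalForm_nonneg hF (l := l) (ε := ε) h X
  have hq0 := hx.focalForm_nonneg hF (l := l) (ε := ε)
    (by rwa [hiso.principalCurvatures_eq q p]) Y
  rw [hY, hq] at hq0
  have hzero : ⟪differential (gaussVector ν) p X, differential (focalMap F x ν l) p X⟫_ℝ = 0 := by
    refine (mul_eq_zero.mp ?_).resolve_left hε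
    refine le_antisymm ?_ hp0
    rw [hp, mul_neg]
    linarith
  have hA := (mem_eigenspace_iff hF.smooth hν).mp hX
  have hpos := fderiv_wulffExtension_pos hF (ν p) (inner_differential_gaussVector hν p X) hdX
  rw [hA, real_inner_comm, inner_smul_right] at hpos
  rw [differential_focalMap hF.smooth hx.smooth hν, hA, smul_smul, inner_add_right,
    inner_smul_right] at hzero
  -- Here df X = (1 - μ/l) dx X, and ⟨dν X, dx X⟩ ≠ 0 because -μ times it equals ⟨A_F dν X, dν X⟩ >
  -- 0.
  have h1 : (1 - l⁻¹ * μ) *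
      ⟪differential (gaussVector ν) p X, differential x p X⟫_ℝ = 0 := by linarith
  rcases mul_eq_zero.mp h1 with h2 | h2
  · refine hne.2 ?_
    field_simp at h2
    linarith
  · rw [h2, mul_zero] at hpos
    exact lt_irrefl _ hpos

theorem exists_principalCurvatures_subset_pair (hF : IsAnisotropicDensity F)
    (hx : IsOrientedHypersurface x ν) (hiso : IsAnisotropicIsoparametric F x ν) (p : M) :
    ∃ l, principalCurvatures F x ν p ⊆ {0, l} := by
  have hfin := finite_principalCurvatures (F := F) hx p
  by_cases hpos : (principalCurvatures F x ν p ∩ Set.Ioi 0).Nonempty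
  · obtain ⟨l, ⟨hlp, hl⟩, hmin⟩ := (hfin.inter_of_left (Set.Ioi 0)).exists_minimal hpos
    simp only [Set.mem_Ioi] at hl
    refine ⟨l, fun μ hμ ↦ eq_zero_or_eq_of_forall_nonneg (ε := 1) hF hx hiso hl.ne' one_ne_zero
      hlp (fun μ hμ ↦ ?_) hμ⟩
    -- No curvature lies strictly between 0 and `l`, so μ(μ - l) ≥ 0 for every μ.
    have hml : -μ * (1 - l⁻¹ * μ) = l⁻¹ * (μ * (μ - l)) := by
      field_simp
      ring
    rw [one_mul, hml]
    refine mul_nonneg (inv_nonneg.mpr hl.le) ?_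
    rcases le_or_gt μ 0 with h | h
    · exact mul_nonneg_of_nonpos_of_nonpos h (by linarith)
    · refine mul_nonneg h.le (sub_nonneg.mpr ?_)
      by_contra! hlt
      exact absurd (hmin ⟨hμ, h⟩ hlt.le) (not_le.mpr hlt)
  · by_cases hneg : (principalCurvatures F x ν p ∩ Set.Iio 0).Nonempty
    · obtain ⟨l, ⟨hlp, hl⟩, hmax⟩ := (hfin.inter_of_left (Set.Iio 0)).exists_maximal hneg
      simp only [Set.mem_Iio] at hl
      refine ⟨l, fun μ hμ ↦ eq_zero_or_eq_of_forall_nonneg (ε := -1) hF hx hiso hl.ne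
        (by norm_num) hlp (fun μ hμ ↦ ?_) hμ⟩
      -- With no positive curvature, every μ is 0 or at most `l` < 0; again μ(μ - l) ≥ 0, but l⁻¹ is
      -- negative, hence ε = -1.
      have hml : -1 * (-μ * (1 - l⁻¹ * μ)) = (-l)⁻¹ * (μ * (μ - l)) := by
        have := hl.ne
        field_simp
        ring
      rw [hml]
      refine mul_nonneg (inv_nonneg.mpr (by linarith)) ?_
      have hμ0 : μ ≤ 0 := by
        by_contra! h
        exact hpos ⟨μ, hμ, h⟩
      rcases hμ0.eq_or_lt with h | h
      · simp [h]
      · refine mul_nonneg_of_nonpos_of_nonpos h.le (sub_nonpos.mpr ?_)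
        by_contra! hlt
        exact absurd (hmax ⟨hμ, h⟩ hlt.le) (not_le.mpr hlt)
    · refine ⟨0, fun μ hμ ↦ ?_⟩
      rcases lt_trichotomy μ 0 with h | h | h
      · exact absurd ⟨μ, hμ, h⟩ hneg
      · simp [h]
      · exact absurd ⟨μ, hμ, h⟩ hpos

end PrincipalCurvatures

end AnisotropicHypersurface

theorem mainTheorem4 (n : ℕ)
    (F : AnisotropicHypersurface.UnitSphere n → ℝ)
    (hF : AnisotropicHypersurface.IsAnisotropicDensity F)
    (M : Type*) [EMetricSpace M] [ChartedSpace (EuclideanSpace ℝ (Fin n)) M]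
    [IsManifold (𝓡 n) ∞ M]
    [RiemannianBundle (fun p : M ↦ TangentSpace (𝓡 n) p)]
    [IsContMDiffRiemannianBundle (𝓡 n) ∞ (EuclideanSpace ℝ (Fin n))
      (fun p : M ↦ TangentSpace (𝓡 n) p)]
    [IsRiemannianManifold (𝓡 n) M]
    [CompleteSpace M]
    (x : M → AnisotropicHypersurface.Ambient n)
    (ν : M → AnisotropicHypersurface.UnitSphere n)
    (hx : AnisotropicHypersurface.IsOrientedHypersurface x ν)
    (hiso : AnisotropicHypersurface.IsAnisotropicIsoparametric F x ν) :
    ∀ p : M,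
      (AnisotropicHypersurface.principalCurvatures F x ν p).encard ≤ 2 ∧
      ((AnisotropicHypersurface.principalCurvatures F x ν p).encard = 2 →
        (0 : ℝ) ∈ AnisotropicHypersurface.principalCurvatures F x ν p) := by
  intro p
  obtain ⟨l, hl⟩ :=
    AnisotropicHypersurface.exists_principalCurvatures_subset_pair hF hx hiso p
  have hpair : ({0, l} : Set ℝ).encard ≤ 2 := by
    refine (Set.encard_insert_le {l} 0).trans ?_
    rw [Set.encard_singleton, one_add_one_eq_two]
  refine ⟨(Set.encard_le_encard hl).trans hpair, fun h2 ↦ ?_⟩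
  have heq := ((Set.toFinite ({0, l} : Set ℝ)).subset hl).eq_of_subset_of_encard_le hl
    (by rw [h2]; exact hpair)
  rw [heq]
  exact Set.mem_insert 0 {l}
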